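/- Let $n\ge 2$ and let $M$ be a smooth ($C^\infty$, Hausdorff, second countable, without boundary) manifold of dimension $n$. Let $S$ be a spray on $M$, that is, a smooth vector field on the slashed tangent bundle $TM\setminus\{0\}$ with $D\pi\circ S=\mathrm{id}$ (where $\pi\colon TM\to M$) and $[C,S]=S$, where $C(v)=\partial_s((1+s)v)|_{s=0}$ is the Liouville vector field. In induced local coordinates $(x,y)$ of $TM$ write $S=y^i\frac{\partial}{\partial x^i}-2G^i(x,y)\frac{\partial}{\partial y^i}$ and put $N^i_j=\partial G^i/\partial y^j$. A geodesic of $S$ on an open interval is a smooth curve $\gamma$ in $M$ with $\gamma'\neq 0$ everywhere and $\gamma''=S\circ\gamma'$; a curve on a compact interval is a geodesic if it extends to a geodesic on an open interval containing it. Let $I=[a,b]$ with $a<b$, and let $c\colon I\to M$ be an injective geodesic of $S$. For a vector field $X$ along $c$ and a $(1,1)$-tensor $J$ along $c$ let, in local coordinates, $$(\nabla X)^i=\frac{dX^i}{dt}+N^i_j(c')X^j,\qquad (\nabla J)^i_j=\frac{dJ^i_j}{dt}+N^i_k(c')J^k_j-J^i_kN^k_j(c'),$$ and let $\Phi$ be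 the $(1,1)$-tensor along $c$ with components $$\Phi^i_j=\Bigl(2\frac{\partial G^i}{\partial x^j}-S\bigl(N^i_j\bigr)-N^i_rN^r_j\Bigr)(c').$$ Let $J$ be an invertible Jacobi tensor along $c$. This means that $J$ is a smooth $(1,1)$-tensor along $c$ with $\nabla^2J+\Phi\circ J=0$, and that there are smooth vector fields $e_1,\dots,e_{n-1}$ along $c$ with $\nabla e_i=0$ such that, for $W_t=\operatorname{span}\{e_1(t),\dots,e_{n-1}(t)\}$: * for some $t_0\in I$, the vectors $e_1(t_0),\dots,e_{n-1}(t_0)$ are linearly independent and $c'(t_0)\notin W_{t_0}$; * for all $t\in I$, $J(c'(t))=0$, $\operatorname{Im}J(t)\subset W_t$, and $J(t)$ restricts to a bijection $W_t\to W_t$. Then there exist an open interval $I^\ast\supset I$, an $\varepsilon>0$ and a map $V\colon I^\ast\times(-\varepsilon,\varepsilon)^{n-1}\to M$ such that 1. $V(t,0,\dots,0)=c(t)$ for all $t\in I$; 2. $V$ is a diffeomorphism onto its range (smooth, injective, with open range and smooth inverse), so that $I^\ast\times(-\varepsilon,\varepsilon)^{n-1}$ provides local coordinates around $c(I)$; 3.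 for every $(s^1,\dots,s^{n-1})\in(-\varepsilon,\varepsilon)^{n-1}$ the curve $t\mapsto V(t,s^1,\dots,s^{n-1})$, $t\in I^\ast$, is a geodesic of $S$. -/

import Mathlib

open Set
open scoped Manifold ContDiff

noncomputable section

namespace SprayGeometry

variable {n : ℕ} {M : Type*} [TopologicalSpace M] [ChartedSpace (EuclideanSpace ℝ (Fin n)) M]
  [IsManifold (𝓡 n) ∞ M]

/-- The model space `ℝⁿ`. -/
abbrev Rn (n : ℕ) : Type := EuclideanSpace ℝ (Fin n)

/-- The slashed tangent bundle `TM \ {0}`. -/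
def slashed : Set (TangentBundle (𝓡 n) M) := {v | v.2 ≠ 0}

/-- The Liouville vector field `C(v) = ∂ₛ ((1 + s) v)|ₛ₌₀` on `TM`. -/
def liouville (v : TangentBundle (𝓡 n) M) : TangentSpace (𝓡 n).tangent v :=
  mfderiv 𝓘(ℝ, ℝ) (𝓡 n).tangent
    (fun s : ℝ => (⟨v.1, (1 + s) • v.2⟩ : TangentBundle (𝓡 n) M)) 0 (1 : ℝ)

/-- `S` is a spray on `M`: a smooth vector field on `TM \ {0}` with `Dπ ∘ S = id` and `[C, S] = S`,
where `C` is the Liouville vector field. (The values of `S` on zero vectors are irrelevant.) -/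
structure IsSpray (S : (v : TangentBundle (𝓡 n) M) → TangentSpace (𝓡 n).tangent v) : Prop where
  smooth : ContMDiffOn (𝓡 n).tangent (𝓡 n).tangent.tangent ∞
    (fun v => (⟨v, S v⟩ : TangentBundle (𝓡 n).tangent (TangentBundle (𝓡 n) M))) slashed
  semispray : ∀ v : TangentBundle (𝓡 n) M, v ∈ slashed →
    mfderiv (𝓡 n).tangent (𝓡 n) (fun w : TangentBundle (𝓡 n) M => w.1) v (S v) = v.2
  homogeneous : ∀ v : TangentBundle (𝓡 n) M, v ∈ slashed →
    VectorField.mlieBracket (𝓡 n).tangent liouville S v = S v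

/-- The tangent `c' : t ↦ (c t, ċ t) ∈ TM` of a curve `c` defined on the set `s`
(one-sided derivatives at the end points, if `s` is a closed interval). -/
def tangentWithin (c : ℝ → M) (s : Set ℝ) (t : ℝ) : TangentBundle (𝓡 n) M :=
  ⟨c t, mfderivWithin 𝓘(ℝ, ℝ) (𝓡 n) c s t (1 : ℝ)⟩

/-- `γ` is a geodesic of `S` on the open set `s ⊆ ℝ`: it is smooth and regular there, and
`γ'' = S ∘ γ'`. -/
structure IsGeodesicOnOpen (S : (v : TangentBundle (𝓡 n) M) → TangentSpace (𝓡 n).tangent v)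
    (γ : ℝ → M) (s : Set ℝ) : Prop where
  smooth : ContMDiffOn 𝓘(ℝ, ℝ) (𝓡 n) ∞ γ s
  regular : ∀ t ∈ s, (tangentWithin γ s t : TangentBundle (𝓡 n) M) ∈ slashed
  geodesic : ∀ t ∈ s,
    mfderivWithin 𝓘(ℝ, ℝ) (𝓡 n).tangent (tangentWithin (n := n) γ s) s t (1 : ℝ) =
      S (tangentWithin γ s t)

/-- `c` is a geodesic of `S` on the compact interval `[a, b]`: it extends to a geodesic on an open
interval containing `[a, b]`. -/
def IsGeodesicOnIcc (S : (v : TangentBundle (𝓡 n) M) → TangentSpace (𝓡 n).tangent v)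
    (c : ℝ → M) (a b : ℝ) : Prop :=
  ∃ (a' b' : ℝ) (γ : ℝ → M), a' < a ∧ b < b' ∧ EqOn γ c (Icc a b) ∧
    IsGeodesicOnOpen S γ (Ioo a' b')

/-! ### Local coordinates

For `p : M` we use the chart `(xⁱ)` of `M` at `p` and the induced coordinates `(x, y)` on `TM`. -/

/-- The induced coordinates `(x, y)` on `TM` of the chart of `M` at `p`. -/
def tangentChart (p : M) : PartialEquiv (TangentBundle (𝓡 n) M) (Rn n × Rn n) :=
  extChartAt (𝓡 n).tangent (⟨p, 0⟩ : TangentBundle (𝓡 n) M)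

/-- The functions `G(x, y) = (Gⁱ(x, y))ᵢ` of `S` in the chart at `p`: the vector field `S` reads
`(x, y) ↦ (y, -2 G(x, y))` in the coordinates `(x, y)`. -/
def sprayCoeff (S : (v : TangentBundle (𝓡 n) M) → TangentSpace (𝓡 n).tangent v) (p : M)
    (z : Rn n × Rn n) : Rn n :=
  let v : TangentBundle (𝓡 n) M := (tangentChart p).symm z
  let X : Rn n × Rn n :=
    mfderiv (𝓡 n).tangent 𝓘(ℝ, Rn n × Rn n) (tangentChart (n := n) p) v (S v)
  (-(1 / 2) : ℝ) • X.2

/-- `N = (∂Gⁱ/∂yʲ)` in the chart at `p`, as a function of `(x, y)`. -/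
def nonlinConn (S : (v : TangentBundle (𝓡 n) M) → TangentSpace (𝓡 n).tangent v) (p : M)
    (z : Rn n × Rn n) : Rn n →L[ℝ] Rn n :=
  fderiv ℝ (fun y : Rn n => sprayCoeff S p (z.1, y)) z.2

/-- The components `Φⁱⱼ = 2 ∂Gⁱ/∂xʲ - S(∂Gⁱ/∂yʲ) - (∂Gⁱ/∂yʳ)(∂Gʳ/∂yʲ)` of the Jacobi endomorphism
in the chart at `p`, as a function of `(x, y)`; here `S` acts as the derivation
`yⁱ ∂/∂xⁱ - 2 Gⁱ ∂/∂yⁱ`. -/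
def jacobiEndo (S : (v : TangentBundle (𝓡 n) M) → TangentSpace (𝓡 n).tangent v) (p : M)
    (z : Rn n × Rn n) : Rn n →L[ℝ] Rn n :=
  (2 : ℝ) • fderiv ℝ (fun x : Rn n => sprayCoeff S p (x, z.2)) z.1
    - fderiv ℝ (nonlinConn S p) z (z.2, (-2 : ℝ) • sprayCoeff S p z)
    - nonlinConn S p z ∘L nonlinConn S p z

/-- The parameters `t ∈ s` for which `c t` lies in the chart of `M` at `p`. -/
def chartTimes (c : ℝ → M) (s : Set ℝ) (p : M) : Set ℝ :=
  s ∩ c ⁻¹' (chartAt (Rn n) p).source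

/-- The components `Xⁱ(t)` in the chart at `p` of a vector field `X` along `c`. -/
def vecComp (c : ℝ → M) (p : M) (X : (t : ℝ) → TangentSpace (𝓡 n) (c t)) (t : ℝ) : Rn n :=
  tangentCoordChange (𝓡 n) (c t) p (c t) (X t)

/-- The components `Jⁱⱼ(t)` in the chart at `p` of a `(1,1)`-tensor `J` along `c`. -/
def endoComp (c : ℝ → M) (p : M)
    (J : (t : ℝ) → TangentSpace (𝓡 n) (c t) →L[ℝ] TangentSpace (𝓡 n) (c t)) (t : ℝ) :
    Rn n →L[ℝ] Rn n :=
  (tangentCoordChange (𝓡 n) (c t) p (c t) : Rn n →L[ℝ] Rn n) ∘L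
    (J t : Rn n →L[ℝ] Rn n) ∘L (tangentCoordChange (𝓡 n) p (c t) (c t) : Rn n →L[ℝ] Rn n)

/-- The coordinates `(x, y)` of `c'(t)` in the chart at `p`. -/
def tangentCoord (c : ℝ → M) (s : Set ℝ) (p : M) (t : ℝ) : Rn n × Rn n :=
  tangentChart p (tangentWithin c s t)

/-- Dynamical covariant derivative in the chart at `p` of a vector field along `c` with components
`X`: `(∇X)ⁱ = dXⁱ/dt + Nⁱⱼ(c') Xʲ`. -/
def covDerivVec (S : (v : TangentBundle (𝓡 n) M) → TangentSpace (𝓡 n).tangent v)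
    (c : ℝ → M) (s : Set ℝ) (p : M) (X : ℝ → Rn n) (t : ℝ) : Rn n :=
  derivWithin X s t + nonlinConn S p (tangentCoord c s p t) (X t)

/-- Dynamical covariant derivative in the chart at `p` of a `(1,1)`-tensor along `c` with
components `A`: `∇A = dA/dt + N(c') ∘ A - A ∘ N(c')`. This is the extension of `∇` from vectors to
`(1,1)`-tensors by the Leibniz rule `∇(A ∘ X) = (∇A) ∘ X + A ∘ ∇X`. -/
def covDerivEndo (S : (v : TangentBundle (𝓡 n) M) → TangentSpace (𝓡 n).tangent v)
    (c : ℝ → M) (s : Set ℝ) (p : M) (A : ℝ → Rn n →L[ℝ] Rn n) (t : ℝ) : Rn n →L[ℝ] Rn n :=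
  derivWithin A s t + nonlinConn S p (tangentCoord c s p t) ∘L A t
    - A t ∘L nonlinConn S p (tangentCoord c s p t)

/-- `X` is a smooth parallel (`∇X = 0`) vector field along `c : s → M`. -/
structure IsParallel (S : (v : TangentBundle (𝓡 n) M) → TangentSpace (𝓡 n).tangent v)
    (c : ℝ → M) (s : Set ℝ) (X : (t : ℝ) → TangentSpace (𝓡 n) (c t)) : Prop where
  smooth : ∀ p : M, ContDiffOn ℝ ∞ (vecComp c p X) (chartTimes (n := n) c s p)
  parallel : ∀ p : M, ∀ t ∈ chartTimes (n := n) c s p,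
    covDerivVec S c s p (vecComp c p X) t = 0

/-- `J` is a Jacobi tensor along `c : s → M`: a smooth `(1,1)`-tensor along `c` with
`∇²J + Φ ∘ J = 0`. -/
structure IsJacobiTensor (S : (v : TangentBundle (𝓡 n) M) → TangentSpace (𝓡 n).tangent v)
    (c : ℝ → M) (s : Set ℝ)
    (J : (t : ℝ) → TangentSpace (𝓡 n) (c t) →L[ℝ] TangentSpace (𝓡 n) (c t)) : Prop where
  smooth : ∀ p : M, ContDiffOn ℝ ∞ (endoComp c p J) (chartTimes (n := n) c s p)
  jacobi : ∀ p : M, ∀ t ∈ chartTimes (n := n) c s p,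
    covDerivEndo S c s p (covDerivEndo S c s p (endoComp c p J)) t
      + jacobiEndo S p (tangentCoord c s p t) ∘L endoComp c p J t = 0

/-- `(W t)` for `t ∈ s` is the family of hyperplanes obtained by parallel transport along `c` of an
`(n-1)`-dimensional subspace of a tangent space `T_{c(t₀)}M`, `t₀ ∈ s`, not containing `c'(t₀)`. -/
def IsParallelHyperplanes (S : (v : TangentBundle (𝓡 n) M) → TangentSpace (𝓡 n).tangent v)
    (c : ℝ → M) (s : Set ℝ) (W : (t : ℝ) → Submodule ℝ (TangentSpace (𝓡 n) (c t))) : Prop :=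
  ∃ e : Fin (n - 1) → (t : ℝ) → TangentSpace (𝓡 n) (c t),
    (∀ i, IsParallel S c s (e i)) ∧
    (∀ t ∈ s, W t = Submodule.span ℝ (range fun i => e i t)) ∧
    ∃ t₀ ∈ s, LinearIndependent ℝ (fun i => e i t₀) ∧ (tangentWithin c s t₀).2 ∉ W t₀

/-- The `(1,1)`-tensor `J` along `c : s → M` is transversal with respect to `(W t)`. -/
def IsTransversal (c : ℝ → M) (s : Set ℝ)
    (W : (t : ℝ) → Submodule ℝ (TangentSpace (𝓡 n) (c t)))
    (J : (t : ℝ) → TangentSpace (𝓡 n) (c t) →L[ℝ] TangentSpace (𝓡 n) (c t)) : Prop :=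
  ∀ t ∈ s, J t (tangentWithin c s t).2 = 0 ∧ ∀ v, J t v ∈ W t

/-- The `(1,1)`-tensor `J` along `c : s → M` is invertible: it is transversal with respect to some
`(W t)` as above, and restricts to an invertible map `W t → W t` for every `t ∈ s`. -/
def IsInvertibleTensor (S : (v : TangentBundle (𝓡 n) M) → TangentSpace (𝓡 n).tangent v)
    (c : ℝ → M) (s : Set ℝ)
    (J : (t : ℝ) → TangentSpace (𝓡 n) (c t) →L[ℝ] TangentSpace (𝓡 n) (c t)) : Prop :=
  ∃ W : (t : ℝ) → Submodule ℝ (TangentSpace (𝓡 n) (c t)),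
    IsParallelHyperplanes S c s W ∧ IsTransversal c s W J ∧
    ∀ t ∈ s, BijOn (J t) (W t : Set (TangentSpace (𝓡 n) (c t))) (W t)

/-- The box `(a', b') × (-ε, ε)ⁿ⁻¹` in `ℝ × ℝⁿ⁻¹`. -/
def box (n : ℕ) (a' b' ε : ℝ) : Set (ℝ × (Fin (n - 1) → ℝ)) :=
  Ioo a' b' ×ˢ univ.pi fun _ => Ioo (-ε) ε

/-- `V` restricts to a diffeomorphism from the open set `D ⊆ ℝ × ℝⁿ⁻¹` onto its range `V(D)`, an
open subset of `M`. -/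
def IsDiffeoOntoRange (V : ℝ × (Fin (n - 1) → ℝ) → M) (D : Set (ℝ × (Fin (n - 1) → ℝ))) : Prop :=
  ContMDiffOn 𝓘(ℝ, ℝ × (Fin (n - 1) → ℝ)) (𝓡 n) ∞ V D ∧ IsOpen (V '' D) ∧
    ∃ U : M → ℝ × (Fin (n - 1) → ℝ), LeftInvOn U V D ∧
      ContMDiffOn (𝓡 n) 𝓘(ℝ, ℝ × (Fin (n - 1) → ℝ)) ∞ U (V '' D)

end SprayGeometry

end

/-! The fields `J ∘ e i` are Jacobi fields along `c`, and the coordinates are a variation of `c`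
through geodesics with exactly these variation fields. In a chart of `TM` around `c'(a)`, take
initial vectors affine in `s` whose derivative in direction `s^i` is the initial value and velocity
of `J ∘ e i`; let `Ψ (t, s)` be the integral curve of `S` from them and `V` its base point. Each
curve `V (·, s)` is then a geodesic by construction. The `s`-derivatives of `Ψ` and the lifted
fields `J ∘ e i` solve the same linearised equation and agree at `a`, so they agree on `[a, b]`
(`variation_eq`).

Hence the differential of `V` at `(t, 0)` sends the standard basis to `c'(t)` and the vectors `J (e
i)`. Parallel fields stay independent (`linearIndependent_of_isParallel`), and `J` is injective on
`W t`, so the `J (e i)` are independent; `c'(t)` is outside `W t`, being a nonzero vector killed by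
`J` (`eq_zero_of_smul_add_tensor_eq_zero`). By the inverse function theorem `V` is a local
diffeomorphism along `[a, b] × {0}`, where it is injective because `c` is. Compactness extends
injectivity to a neighbourhood, and the tube lemma places a box inside it.

Two tools carry the analysis. Smooth flows come from the inverse function theorem in `C([-1, 1],
E)`: solutions of `u(r) = x + τ ∫₀ʳ f(u)` are the zeros of a smooth map with invertible derivative
at `τ = 0` (`exists_contDiffOn_flow`), and connectedness of `[a, b]` continues local families over
the whole interval (`exists_isIntegralFamily`). Linear equations along `c` exist only chart by
chart; `linear_propagation` carries a zero of a solution from chart to chart. -/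

open scoped Topology

/-! ### Smoothness of composition operators on spaces of continuous maps -/

namespace ContinuousMap

variable {K : Type*} [TopologicalSpace K] [CompactSpace K]

/-- Pointwise application of a continuous family of continuous linear maps, as a continuous bilinear
map. -/
noncomputable def applyCLM (K : Type*) [TopologicalSpace K] [CompactSpace K] (E F : Type*)
    [NormedAddCommGroup E] [NormedSpace ℝ E] [NormedAddCommGroup F] [NormedSpace ℝ F] :
    C(K, E →L[ℝ] F) →L[ℝ] C(K, E) →L[ℝ] C(K, F) :=
  LinearMap.mkContinuous₂
    (LinearMap.mk₂ ℝ (fun (A : C(K, E →L[ℝ] F)) (u : C(K, E)) =>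
        (⟨fun k => A k (u k), by fun_prop⟩ : C(K, F)))
      (fun _ _ _ => by ext; simp) (fun _ _ _ => by ext; simp)
      (fun _ _ _ => by ext; simp) (fun _ _ _ => by ext; simp))
    1 (fun A u => by
      rw [one_mul, ContinuousMap.norm_le _ (by positivity)]
      intro k
      exact ((A k).le_opNorm (u k)).trans
        (mul_le_mul (A.norm_coe_le_norm k) (u.norm_coe_le_norm k) (norm_nonneg _) (norm_nonneg A)))

@[simp]
theorem applyCLM_apply {E F : Type*}
    [NormedAddCommGroup E] [NormedSpace ℝ E] [NormedAddCommGroup F] [NormedSpace ℝ F]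
    (A : C(K, E →L[ℝ] F)) (u : C(K, E)) (k : K) : applyCLM K E F A u k = A k (u k) := rfl

/-- The pointwise first-order error of `f` is uniform in `k`, because `u ↦ f' ∘ u` is continuous for
the sup norm. -/
theorem hasFDerivAt_comp_left {E F : Type*}
    [NormedAddCommGroup E] [NormedSpace ℝ E] [NormedAddCommGroup F] [NormedSpace ℝ F]
    (f : C(E, F)) (f' : C(E, E →L[ℝ] F)) (hf : ∀ x, HasFDerivAt f (f' x) x) (u : C(K, E)) :
    HasFDerivAt (fun u : C(K, E) => f.comp u) (applyCLM K E F (f'.comp u)) u := by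
  refine HasFDerivAtFilter.of_isLittleO (Asymptotics.isLittleO_iff.2 fun ε hε => ?_)
  have hc : Continuous (fun u : C(K, E) => f'.comp u) := ContinuousMap.continuous_postcomp f'
  obtain ⟨δ, hδ, H⟩ := (Metric.continuousAt_iff (f := fun u : C(K, E) => f'.comp u) (a := u)).1
    hc.continuousAt ε hε
  have hev : ∀ᶠ w in 𝓝 u, dist w u < δ := Metric.ball_mem_nhds u hδ
  rw [Filter.prod_pure, Filter.eventually_map]
  filter_upwards [hev] with w hw
  rw [ContinuousMap.norm_le _ (by positivity)]
  intro k
  have bound : ∀ z ∈ Metric.ball (u k) δ, ‖f' z - f' (u k)‖ ≤ ε := by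
    intro z hz
    -- Shifting `u` by the constant `z - u k` gives a function within `δ` of `u` that takes the
    -- value `z` at `k`; the choice of `δ` then bounds `f' z - f' (u k)` independently of `k`.
    have h1 : dist (u + ContinuousMap.const K (z - u k)) u < δ := by
      rw [dist_eq_norm, add_sub_cancel_left]
      refine lt_of_le_of_lt ((ContinuousMap.norm_le _ (norm_nonneg (z - u k))).2 fun _ => ?_)
        (mem_ball_iff_norm.1 hz)
      simp
    have h2 := (ContinuousMap.dist_apply_le_dist k).trans (H h1).le
    simpa [dist_eq_norm] using h2
  have hwk : w k ∈ Metric.ball (u k) δ :=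
    Metric.mem_ball.2 (lt_of_le_of_lt (ContinuousMap.dist_apply_le_dist k) hw)
  have := (convex_ball (u k) δ).norm_image_sub_le_of_norm_hasFDerivWithin_le'
    (fun x _ => (hf x).hasFDerivWithinAt) bound (Metric.mem_ball_self hδ) hwk
  simp only [coe_sub, comp_apply, Pi.sub_apply, applyCLM_apply] at this ⊢
  refine this.trans (mul_le_mul_of_nonneg_left ?_ hε.le)
  exact (w - u).norm_coe_le_norm k

/-- The derivative of `u ↦ f ∘ u` is the composition operator of `f'` followed by a continuous
linear map, so regularity is gained by induction. As `f'` takes values in `E →L[ℝ] F`, the target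
varies in the induction and shares the universe of `E`. -/
theorem contDiff_nat_comp_left {E : Type u} [NormedAddCommGroup E] [NormedSpace ℝ E] (n : ℕ) :
    ∀ {F : Type u} [NormedAddCommGroup F] [NormedSpace ℝ F] (f : C(E, F)), ContDiff ℝ n f →
      ContDiff ℝ n (fun u : C(K, E) => f.comp u) := by
  induction n with
  | zero =>
    intro F _ _ f _
    exact contDiff_zero.2 (ContinuousMap.continuous_postcomp f)
  | succ n ih =>
    intro F _ _ f hf
    obtain ⟨f', hf', hd⟩ := contDiff_succ_iff_hasFDerivAt.1 hf
    have h := (applyCLM K E F).contDiff (n := n).comp (ih ⟨f', hf'.continuous⟩ hf')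
    exact contDiff_succ_iff_hasFDerivAt.2
      ⟨fun u => applyCLM K E F ((⟨f', hf'.continuous⟩ : C(E, E →L[ℝ] F)).comp u),
        h, hasFDerivAt_comp_left f ⟨f', hf'.continuous⟩ hd⟩

/-- Composition on the left with a smooth map is a smooth operator on spaces of continuous maps. -/
theorem contDiff_comp_left {E F : Type u} [NormedAddCommGroup E] [NormedSpace ℝ E]
    [NormedAddCommGroup F] [NormedSpace ℝ F] (f : C(E, F)) (hf : ContDiff ℝ ∞ f) :
    ContDiff ℝ ∞ (fun u : C(K, E) => f.comp u) :=
  contDiff_infty.2 fun n => contDiff_nat_comp_left n f (contDiff_infty.1 hf n)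

end ContinuousMap

/-! ### The inverse function theorem for smooth maps -/

/-- The pointwise inverse function theorem gives smoothness of the inverse at one image point.
Invertibility of the derivative is an open condition, so after restricting the source to it the
theorem applies at every point of the target. -/
theorem exists_openPartialHomeomorph_contDiffOn_symm {E F : Type*} [NormedAddCommGroup E]
    [NormedSpace ℝ E] [CompleteSpace E] [NormedAddCommGroup F] [NormedSpace ℝ F]
    {f : E → F} {W : Set E} (hW : IsOpen W) (hf : ContDiffOn ℝ ∞ f W) {x : E} (hx : x ∈ W)
    (f' : E ≃L[ℝ] F) (hf' : HasFDerivAt f (f' : E →L[ℝ] F) x) :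
    ∃ e : OpenPartialHomeomorph E F, x ∈ e.source ∧ e.source ⊆ W ∧ ⇑e = f ∧
      ContDiffOn ℝ ∞ e.symm e.target := by
  have hne : (∞ : WithTop ℕ∞) ≠ 0 := by simp
  have hfx : ContDiffAt ℝ ∞ f x := hf.contDiffAt (hW.mem_nhds hx)
  let e₀ := hfx.toOpenPartialHomeomorph f hf' hne
  have he₀ : ⇑e₀ = f := hfx.toOpenPartialHomeomorph_coe hf' hne
  have hopen : IsOpen (W ∩ fderiv ℝ f ⁻¹' range ((↑) : (E ≃L[ℝ] F) → E →L[ℝ] F)) :=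
    (hf.continuousOn_fderiv_of_isOpen hW (by simp)).isOpen_inter_preimage hW
      ContinuousLinearEquiv.isOpen
  refine ⟨e₀.restrOpen _ hopen, ⟨hfx.mem_toOpenPartialHomeomorph_source hf' hne, hx, ?_⟩, ?_, ?_, ?_⟩
  · exact ⟨f', hf'.fderiv.symm⟩
  · intro y hy
    exact hy.2.1
  · exact he₀
  · intro y hy
    have hy' := (e₀.restrOpen _ hopen).map_target hy
    set z := (e₀.restrOpen _ hopen).symm y with hz
    obtain ⟨g, hg⟩ := hy'.2.2
    have hfz : ContDiffAt ℝ ∞ f z := hf.contDiffAt (hW.mem_nhds hy'.2.1)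
    refine ContDiffAt.contDiffWithinAt ?_
    refine OpenPartialHomeomorph.contDiffAt_symm (f₀' := g) _ hy ?_ ?_
    · rw [hg]
      exact (hfz.differentiableAt (by simp)).hasFDerivAt
    · exact hfz

/-! ### Smooth local flows in Banach spaces -/

namespace SmoothFlow

variable {E : Type u} [NormedAddCommGroup E] [NormedSpace ℝ E]

/-- The integration operator `u ↦ (r ↦ ∫₀ʳ u)` on continuous functions on `[-1, 1]`. -/
noncomputable def integralCLM (E : Type*) [NormedAddCommGroup E] [NormedSpace ℝ E] :
    C(Icc (-1 : ℝ) 1, E) →L[ℝ] C(Icc (-1 : ℝ) 1, E) :=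
  LinearMap.mkContinuous
    { toFun := fun u => ⟨fun r => ∫ x in (0 : ℝ)..r, u (projIcc (-1) 1 (by norm_num) x), by
          have : Continuous fun x : ℝ => u (projIcc (-1) 1 (by norm_num) x) :=
            u.continuous.comp continuous_projIcc
          exact (intervalIntegral.continuous_primitive
            (fun a b => this.intervalIntegrable a b) 0).comp continuous_subtype_val⟩
      map_add' := fun u w => by
        ext r
        have h : ∀ u : C(Icc (-1 : ℝ) 1, E),
            Continuous fun x : ℝ => u (projIcc (-1) 1 (by norm_num) x) :=
          fun u => u.continuous.comp continuous_projIcc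
        exact intervalIntegral.integral_add ((h u).intervalIntegrable _ _)
          ((h w).intervalIntegrable _ _)
      map_smul' := fun c u => by
        ext r
        exact intervalIntegral.integral_smul c _ }
    1 (fun u => by
      rw [one_mul, ContinuousMap.norm_le _ (norm_nonneg u)]
      intro r
      refine (intervalIntegral.norm_integral_le_of_norm_le_const (C := ‖u‖)
        fun x _ => u.norm_coe_le_norm _).trans ?_
      have : |(r : ℝ) - 0| ≤ 1 := by rw [sub_zero, abs_le]; exact r.2
      exact mul_le_of_le_one_right (norm_nonneg _) this)

theorem integralCLM_apply (u : C(Icc (-1 : ℝ) 1, E)) (r : Icc (-1 : ℝ) 1) :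
    integralCLM E u r = ∫ x in (0 : ℝ)..r, u (projIcc (-1) 1 (by norm_num) x) := rfl

/-- Restriction of a continuous function on `[-1, 1]` to `[-|r|, |r|]`, rescaled to `[-1, 1]`. -/
def rescale (r : Icc (-1 : ℝ) 1) (u : C(Icc (-1 : ℝ) 1, E)) : C(Icc (-1 : ℝ) 1, E) :=
  u.comp ⟨fun q => ⟨r * q, by
    have := abs_le.2 r.2
    have := abs_le.2 q.2
    rw [mem_Icc, ← abs_le, abs_mul]
    exact mul_le_one₀ ‹_› (abs_nonneg _) ‹_›⟩, by fun_prop⟩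

omit [NormedSpace ℝ E] in
theorem rescale_apply (r : Icc (-1 : ℝ) 1) (u : C(Icc (-1 : ℝ) 1, E)) (q : Icc (-1 : ℝ) 1)
    (h : (r * q : ℝ) ∈ Icc (-1 : ℝ) 1) : rescale r u q = u ⟨r * q, h⟩ := rfl

/-- The substitution `x ↦ r x` in the integral. It makes a rescaled solution with parameter `τ` a
solution with parameter `r τ`. -/
theorem integralCLM_rescale (r : Icc (-1 : ℝ) 1) (u : C(Icc (-1 : ℝ) 1, E)) :
    (r : ℝ) • integralCLM E (rescale r u) = rescale r (integralCLM E u) := by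
  ext q
  have h : (r * q : ℝ) ∈ Icc (-1 : ℝ) 1 := by
    have := abs_le.2 r.2
    have := abs_le.2 q.2
    rw [mem_Icc, ← abs_le, abs_mul]
    exact mul_le_one₀ ‹_› (abs_nonneg _) ‹_›
  rw [rescale_apply r _ q h, ContinuousMap.smul_apply, integralCLM_apply, integralCLM_apply]
  have key := intervalIntegral.smul_integral_comp_mul_left (a := 0) (b := (q : ℝ))
    (fun x : ℝ => u (projIcc (-1) 1 (by norm_num) x)) (r : ℝ)
  rw [mul_zero] at key
  rw [← key]
  congr 1
  refine intervalIntegral.integral_congr fun x hx => ?_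
  have hx' : x ∈ Icc (-1 : ℝ) 1 := by
    have hq := q.2
    rcases le_total 0 (q : ℝ) with h0 | h0
    · rw [uIcc_of_le h0] at hx
      exact ⟨by linarith [hx.1], hx.2.trans hq.2⟩
    · rw [uIcc_of_ge h0] at hx
      exact ⟨hq.1.trans hx.1, by linarith [hx.2]⟩
  have hrx : (r * x : ℝ) ∈ Icc (-1 : ℝ) 1 := by
    have := abs_le.2 r.2
    have := abs_le.2 hx'
    rw [mem_Icc, ← abs_le, abs_mul]
    exact mul_le_one₀ ‹_› (abs_nonneg _) ‹_›
  rw [projIcc_of_mem _ hx', projIcc_of_mem _ hrx]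
  rfl

/-- The map whose zero set consists of the solutions of `u(r) = x + τ ∫₀ʳ f(u)`. -/
noncomputable def picardMap (f : C(E, E)) (p : E × ℝ × C(Icc (-1 : ℝ) 1, E)) :
    E × ℝ × C(Icc (-1 : ℝ) 1, E) :=
  (p.1, p.2.1, p.2.2 - ContinuousMap.const _ p.1 - p.2.1 • integralCLM E (f.comp p.2.2))

/-- Constant functions, as a continuous linear map. -/
noncomputable def constCLM (E : Type*) [NormedAddCommGroup E] [NormedSpace ℝ E] :
    E →L[ℝ] C(Icc (-1 : ℝ) 1, E) :=
  LinearMap.mkContinuous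
    { toFun := fun x => ContinuousMap.const _ x
      map_add' := fun _ _ => rfl
      map_smul' := fun _ _ => rfl } 1 (fun x => by
      rw [one_mul]
      exact (ContinuousMap.norm_le _ (norm_nonneg x)).2 fun _ => le_rfl)

@[simp]
theorem constCLM_apply (x : E) : constCLM E x = ContinuousMap.const _ x := rfl

theorem contDiff_picardMap (f : C(E, E)) (hf : ContDiff ℝ ∞ f) : ContDiff ℝ ∞ (picardMap f) := by
  have h := (ContinuousMap.contDiff_comp_left (K := Icc (-1 : ℝ) 1) f hf).comp
    (contDiff_snd.comp contDiff_snd : ContDiff ℝ ∞ fun p : E × ℝ × C(Icc (-1 : ℝ) 1, E) => p.2.2)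
  have h2 := (integralCLM E).contDiff.comp h
  exact contDiff_fst.prodMk (contDiff_snd.fst.prodMk
    ((contDiff_snd.snd.sub ((constCLM E).contDiff.comp contDiff_fst)).sub
      (contDiff_snd.fst.smul h2)))

/-- The derivative of `picardMap f` at `(x, 0, x)`. -/
noncomputable def picardDeriv (w : C(Icc (-1 : ℝ) 1, E)) :
    (E × ℝ × C(Icc (-1 : ℝ) 1, E)) ≃L[ℝ] (E × ℝ × C(Icc (-1 : ℝ) 1, E)) :=
  -- The map is `id - N` with `N = inj ∘ pr`. Since `pr ∘ inj = 0`, `N² = 0` and the inverse is `id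
  -- + N`.
  let pr : (E × ℝ × C(Icc (-1 : ℝ) 1, E)) →L[ℝ] C(Icc (-1 : ℝ) 1, E) :=
    constCLM E ∘L .fst ℝ _ _ + (ContinuousLinearMap.toSpanSingleton ℝ w) ∘L
      .fst ℝ _ _ ∘L .snd ℝ _ _
  let inj : C(Icc (-1 : ℝ) 1, E) →L[ℝ] (E × ℝ × C(Icc (-1 : ℝ) 1, E)) := .inr ℝ _ _ ∘L .inr ℝ _ _
  ContinuousLinearEquiv.equivOfInverse (.id ℝ _ - inj ∘L pr) (.id ℝ _ + inj ∘L pr)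
    (fun p => by simp [pr, inj]) (fun p => by simp [pr, inj])

/-- At `τ = 0` the derivative of `f` drops out: the product rule for `τ • ∫ f(u)` leaves only the
variation of `τ`. This is why invertibility needs no estimate. -/
theorem hasFDerivAt_picardMap (f : C(E, E)) (hf : ContDiff ℝ ∞ f) (x : E) :
    HasFDerivAt (picardMap f)
      (picardDeriv (integralCLM E (f.comp (ContinuousMap.const _ x))) :
        (E × ℝ × C(Icc (-1 : ℝ) 1, E)) →L[ℝ] (E × ℝ × C(Icc (-1 : ℝ) 1, E)))
      (x, 0, ContinuousMap.const _ x) := by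
  set p₀ : E × ℝ × C(Icc (-1 : ℝ) 1, E) := (x, 0, ContinuousMap.const _ x) with hp₀
  have hN := ((ContinuousMap.contDiff_comp_left (K := Icc (-1 : ℝ) 1) f hf).comp
    (contDiff_snd.comp contDiff_snd : ContDiff ℝ ∞ fun p : E × ℝ × C(Icc (-1 : ℝ) 1, E) => p.2.2))
  have hT := ((integralCLM E).contDiff.comp hN).differentiable (by simp) p₀
  have h1 : HasFDerivAt (fun p : E × ℝ × C(Icc (-1 : ℝ) 1, E) => p.1) (.fst ℝ _ _) p₀ :=
    hasFDerivAt_fst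
  have h2 : HasFDerivAt (fun p : E × ℝ × C(Icc (-1 : ℝ) 1, E) => p.2.1)
      (.fst ℝ _ _ ∘L .snd ℝ _ _) p₀ := hasFDerivAt_fst.comp p₀ hasFDerivAt_snd
  have h3 : HasFDerivAt (fun p : E × ℝ × C(Icc (-1 : ℝ) 1, E) => p.2.2)
      (.snd ℝ _ _ ∘L .snd ℝ _ _) p₀ := hasFDerivAt_snd.comp p₀ hasFDerivAt_snd
  have h4 := h2.smul hT.hasFDerivAt
  have h5 := (h3.sub ((constCLM E).hasFDerivAt.comp p₀ h1)).sub h4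
  refine (h1.prodMk (h2.prodMk h5)).congr_fderiv ?_
  refine ContinuousLinearMap.ext fun q => ?_
  refine Prod.ext ?_ (Prod.ext ?_ ?_) <;> simp [picardDeriv, hp₀, sub_sub]

/-- Inverting `picardMap` near `(x₀, 0, x₀)` gives a solution `ψ x t` on `[-1, 1]` of the equation
with time scale `t`, smooth in `(x, t)`; its value at `1` is the flow at time `t`. -/
theorem exists_contDiffOn_flow [CompleteSpace E] (f : E → E) (hf : ContDiff ℝ ∞ f) (x₀ : E) :
    ∃ δ > 0, ∃ B : Set E, IsOpen B ∧ x₀ ∈ B ∧ ∃ Φ : ℝ × E → E,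
      ContDiffOn ℝ ∞ Φ (Ioo (-δ) δ ×ˢ B) ∧ (∀ x ∈ B, Φ (0, x) = x) ∧
      ∀ x ∈ B, ∀ t ∈ Ioo (-δ) δ, HasDerivAt (fun t => Φ (t, x)) (f (Φ (t, x))) t := by
  let F : C(E, E) := ⟨f, hf.continuous⟩
  let p₀ : E × ℝ × C(Icc (-1 : ℝ) 1, E) := (x₀, 0, ContinuousMap.const _ x₀)
  obtain ⟨e, hpe, -, he, hsymm⟩ := exists_openPartialHomeomorph_contDiffOn_symm isOpen_univ
    (contDiff_picardMap F hf).contDiffOn (mem_univ p₀) _ (hasFDerivAt_picardMap F hf x₀)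
  obtain ⟨ρ, hρ, hball⟩ := Metric.isOpen_iff.1 e.open_source p₀ hpe
  have hep₀ : e p₀ = (x₀, 0, 0) := by
    rw [he]
    simp [picardMap, p₀]
  have hq₀ : ((x₀, 0, 0) : E × ℝ × C(Icc (-1 : ℝ) 1, E)) ∈ e.target := hep₀ ▸ e.map_source hpe
  have hq₀' : e.symm (x₀, 0, 0) = p₀ := by rw [← hep₀, e.left_inv hpe]
  have hnhds : e.target ∩ e.symm ⁻¹' Metric.ball p₀ ρ ∈ 𝓝 (x₀, (0 : ℝ), 0) := by
    refine Filter.inter_mem (e.open_target.mem_nhds hq₀) ((e.continuousAt_symm hq₀) ?_)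
    rw [hq₀']
    exact Metric.ball_mem_nhds _ hρ
  obtain ⟨δ, hδ, hδball⟩ := Metric.mem_nhds_iff.1 hnhds
  have hmem : ∀ x ∈ Metric.ball x₀ δ, ∀ t : ℝ, |t| < δ →
      ((x, t, 0) : E × ℝ × C(Icc (-1 : ℝ) 1, E)) ∈ e.target ∩ e.symm ⁻¹' Metric.ball p₀ ρ := by
    intro x hx t ht
    apply hδball
    rw [← ball_prod_same, ← ball_prod_same]
    exact ⟨hx, by simpa using ht, Metric.mem_ball_self hδ⟩
  let ψ : E → ℝ → C(Icc (-1 : ℝ) 1, E) := fun x t => (e.symm (x, t, 0)).2.2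
  have hψ : ∀ x ∈ Metric.ball x₀ δ, ∀ t : ℝ, |t| < δ → e.symm (x, t, 0) = (x, t, ψ x t) ∧
      ψ x t = ContinuousMap.const _ x + t • integralCLM E (F.comp (ψ x t)) := by
    intro x hx t ht
    have h1 := e.right_inv (hmem x hx t ht).1
    rw [he] at h1
    have ha : (e.symm (x, t, 0)).1 = x := congrArg Prod.fst h1
    have hb : (e.symm (x, t, 0)).2.1 = t := congrArg (fun p => p.2.1) h1
    have hc := congrArg (fun p => p.2.2) h1
    simp only [picardMap] at hc
    rw [ha, hb, sub_sub, sub_eq_zero] at hc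
    exact ⟨Prod.ext ha (Prod.ext hb rfl), hc⟩
  -- Any positive number below `δ` serves: all solutions for shorter times are rescalings of the
  -- single solution `ψ x τ`.
  let τ : ℝ := δ / 2
  have hτ : 0 < τ := half_pos hδ
  have hτδ : |τ| < δ := by rw [abs_of_pos hτ]; exact half_lt_self hδ
  have hresc : ∀ x ∈ Metric.ball x₀ δ, ∀ r : Icc (-1 : ℝ) 1,
      ψ x (r * τ) = rescale r (ψ x τ) := by
    intro x hx r
    obtain ⟨h1, h2⟩ := hψ x hx τ hτδ
    have h3 := (hmem x hx τ hτδ).2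
    rw [mem_preimage, h1, ← ball_prod_same, ← ball_prod_same] at h3
    have hr := abs_le.2 r.2
    have hrτ : |(r : ℝ) * τ| ≤ |τ| := by
      rw [abs_mul]
      exact mul_le_of_le_one_left (abs_nonneg _) hr
    have hsrc : ((x, (r : ℝ) * τ, rescale r (ψ x τ)) : E × ℝ × C(Icc (-1 : ℝ) 1, E)) ∈
        e.source := by
      -- Rescaling does not increase the distance to a constant function, so the rescaled solution
      -- stays in the ball where `picardMap` is injective. Having the same image, it must be `ψ x (r
      -- τ)`.
      apply hball
      rw [← ball_prod_same, ← ball_prod_same]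
      refine ⟨h3.1, ?_, ?_⟩
      · have := h3.2.1
        simp only [Metric.mem_ball, dist_zero_right, Real.norm_eq_abs] at this ⊢
        exact hrτ.trans_lt this
      · refine lt_of_le_of_lt ?_ (Metric.mem_ball.1 h3.2.2)
        refine (ContinuousMap.dist_le dist_nonneg).2 fun q => ?_
        exact ContinuousMap.dist_apply_le_dist (f := ψ x τ) (g := ContinuousMap.const _ x₀) _
    have hval : e (x, (r : ℝ) * τ, rescale r (ψ x τ)) = (x, (r : ℝ) * τ, 0) := by
      rw [he]
      refine Prod.ext rfl (Prod.ext rfl ?_)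
      simp only [picardMap]
      have h4 : F.comp (rescale r (ψ x τ)) = rescale r (F.comp (ψ x τ)) := rfl
      have h5 : rescale r (ψ x τ) =
          ContinuousMap.const _ x + τ • rescale r (integralCLM E (F.comp (ψ x τ))) := by
        conv_lhs => rw [h2]
        rfl
      rw [h4, mul_comm, mul_smul, integralCLM_rescale, sub_sub, sub_eq_zero]
      exact h5
    have := e.left_inv hsrc
    rw [hval] at this
    exact congrArg (fun p => p.2.2) this
  let one : Icc (-1 : ℝ) 1 := ⟨1, by norm_num, le_rfl⟩
  let Φ : ℝ × E → E := fun p => ψ p.2 p.1 one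
  have habs : ∀ t ∈ Ioo (-τ) τ, |t| < δ := fun t ht =>
    (abs_lt.2 ht).trans (by rw [abs_of_pos hτ] at hτδ; exact hτδ)
  refine ⟨τ, hτ, Metric.ball x₀ δ, Metric.isOpen_ball, Metric.mem_ball_self hδ, Φ, ?_, ?_, ?_⟩
  · have h1 : ContDiffOn ℝ ∞ (fun p : ℝ × E => e.symm (p.2, p.1, 0))
        (Ioo (-τ) τ ×ˢ Metric.ball x₀ δ) :=
      hsymm.comp (contDiff_snd.prodMk (contDiff_fst.prodMk contDiff_const)).contDiffOn
        fun p hp => (hmem p.2 hp.2 p.1 (habs _ hp.1)).1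
    have h2 := (ContinuousMap.evalCLM ℝ one : C(Icc (-1 : ℝ) 1, E) →L[ℝ] E).contDiff.comp_contDiffOn
      (contDiff_snd.comp contDiff_snd |>.comp_contDiffOn h1)
    exact h2
  · intro x hx
    have h := (hψ x hx 0 (by simpa using hδ)).2
    simp only [Φ]
    rw [h]
    simp
  · intro x hx t ht
    have h := (hψ x hx τ hτδ).2
    set w := ψ x τ with hw
    let g : ℝ → E := fun s => F (w (projIcc (-1) 1 (by norm_num) s))
    have hg : Continuous g := F.continuous.comp (w.continuous.comp continuous_projIcc)
    have hval : ∀ s ∈ Ioo (-τ) τ, ∃ hs : s / τ ∈ Icc (-1 : ℝ) 1, Φ (s, x) = w ⟨s / τ, hs⟩ := by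
      intro s hs
      have hs' : s / τ ∈ Icc (-1 : ℝ) 1 := by
        rw [mem_Icc, le_div_iff₀ hτ, div_le_iff₀ hτ]
        constructor <;> linarith [hs.1, hs.2]
      refine ⟨hs', ?_⟩
      have h1 := hresc x hx ⟨s / τ, hs'⟩
      simp only at h1
      rw [div_mul_cancel₀ _ hτ.ne'] at h1
      simp only [Φ, h1]
      rw [rescale_apply _ _ _ (by simpa [one] using hs')]
      congr 2
      simp [one]
    -- With `x` fixed, `Φ (s, x)` is the one function `w` at `s / τ`, so the integral equation can
    -- be differentiated in `s`.
    have hW : ∀ s ∈ Ioo (-τ) τ, Φ (s, x) = x + τ • ∫ y in (0 : ℝ)..(s / τ), g y := by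
      intro s hs
      obtain ⟨hs', h1⟩ := hval s hs
      rw [h1, h]
      simp only [ContinuousMap.add_apply, ContinuousMap.const_apply, ContinuousMap.smul_apply,
        integralCLM_apply]
      rfl
    have hd : HasDerivAt (fun s : ℝ => x + τ • ∫ y in (0 : ℝ)..(s / τ), g y)
        (τ • ((1 / τ) • g (t / τ))) t := by
      have h1 := intervalIntegral.integral_hasDerivAt_right (hg.intervalIntegrable 0 (t / τ))
        hg.stronglyMeasurable.stronglyMeasurableAtFilter hg.continuousAt
      have h2 : HasDerivAt (fun s : ℝ => s / τ) (1 / τ) t := (hasDerivAt_id t).div_const τ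
      exact ((h1.scomp t h2).const_smul τ).const_add x
    obtain ⟨ht', h1⟩ := hval t ht
    have h3 : τ • ((1 / τ) • g (t / τ)) = f (Φ (t, x)) := by
      rw [smul_smul, mul_one_div_cancel hτ.ne', one_smul, h1]
      simp only [g]
      rw [projIcc_of_mem _ ht']
      rfl
    rw [h3] at hd
    refine hd.congr_of_eventuallyEq ?_
    filter_upwards [isOpen_Ioo.mem_nhds ht] with s hs using hW s hs

end SmoothFlow

/-! ### Smooth families of integral curves on manifolds -/

namespace SmoothFlow

section Manifold

variable {E : Type u} [NormedAddCommGroup E] [NormedSpace ℝ E]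
  {H : Type*} [TopologicalSpace H] {I : ModelWithCorners ℝ E H} [I.Boundaryless]
  {N : Type*} [TopologicalSpace N] [ChartedSpace H N] [IsManifold I ∞ N]

variable (I) in
/-- The vector field `v` in the chart at `x₀`. -/
noncomputable def fieldInChart (x₀ : N) (v : (x : N) → TangentSpace I x) (z : E) : E :=
  tangentCoordChange I ((extChartAt I x₀).symm z) x₀ ((extChartAt I x₀).symm z)
    (v ((extChartAt I x₀).symm z))

omit [I.Boundaryless] in
theorem contDiffOn_fieldInChart {v : (x : N) → TangentSpace I x} {U : Set N}
    (hv : ContMDiffOn I I.tangent ∞ (fun x => (⟨x, v x⟩ : TangentBundle I N)) U) (x₀ : N) :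
    ContDiffOn ℝ ∞ (fieldInChart I x₀ v)
      ((extChartAt I x₀).target ∩ (extChartAt I x₀).symm ⁻¹' U) := by
  have h1 := (contMDiffOn_extChartAt_symm (I := I) (n := ∞) x₀).mono
    (inter_subset_left (t := (extChartAt I x₀).symm ⁻¹' U))
  have h2 := hv.comp h1 inter_subset_right
  have h3 := contMDiffOn_extChartAt (I := I.tangent) (n := ∞) (x := (⟨x₀, 0⟩ : TangentBundle I N))
  have h4 := h3.comp h2 (fun z hz => by
    rw [mem_preimage, TangentBundle.mem_chart_source_iff]
    have := (extChartAt I x₀).map_target hz.1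
    rwa [extChartAt_source] at this)
  exact (contMDiffOn_iff_contDiffOn.1 h4).snd

/-- A solution of the equation in the chart is an integral curve. -/
theorem hasMFDerivAt_of_hasDerivAt_fieldInChart {v : (x : N) → TangentSpace I x} {x₀ : N}
    {f : ℝ → E} {t : ℝ} (ht : f t ∈ (extChartAt I x₀).target)
    (h : HasDerivAt f (fieldInChart I x₀ v (f t)) t) :
    HasMFDerivAt 𝓘(ℝ, ℝ) I (fun t => (extChartAt I x₀).symm (f t)) t
      ((1 : ℝ →L[ℝ] ℝ).smulRight (v ((extChartAt I x₀).symm (f t)))) := by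
  set xt : N := (extChartAt I x₀).symm (f t) with hxt
  have hft1 : xt ∈ (extChartAt I x₀).source := (extChartAt I x₀).map_target ht
  have hft2 := mem_extChartAt_source (I := I) xt
  suffices key : HasDerivAt ((extChartAt I xt ∘ (extChartAt I x₀).symm) ∘ f) (v xt : E) t by
    refine ⟨(continuousAt_extChartAt_symm'' ht).comp h.continuousAt, ?_⟩
    have h1 := key.hasFDerivAt.hasFDerivWithinAt (s := range 𝓘(ℝ, ℝ))
    exact h1
  -- The manifold derivative is read in the chart at the point itself, the equation in the chart at
  -- `x₀`; the derivative of the transition map undoes the coordinate change inside `fieldInChart`.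
  have e : ∀ w : E, tangentCoordChange I x₀ xt xt (tangentCoordChange I xt x₀ xt w) = w :=
    fun w => (tangentCoordChange_comp ⟨⟨hft2, hft1⟩, hft2⟩).trans (tangentCoordChange_self hft2)
  have key := hasFDerivWithinAt_tangentCoordChange (I := I) ⟨hft1, hft2⟩
  rw [I.range_eq_univ, hasFDerivWithinAt_univ, hxt, (extChartAt I x₀).right_inv ht] at key
  exact (key.comp_hasDerivAt t h).congr_deriv (e (v xt))

/-- Smooth local flows on manifolds, for a smooth family of initial values. -/
theorem exists_local_family [FiniteDimensional ℝ E] {v : (x : N) → TangentSpace I x} {U : Set N}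
    (hU : IsOpen U)
    (hv : ContMDiffOn I I.tangent ∞ (fun x => (⟨x, v x⟩ : TangentBundle I N)) U)
    {x₀ : N} (hx₀ : x₀ ∈ U) :
    ∃ δ > 0, ∃ O : Set N, IsOpen O ∧ x₀ ∈ O ∧
      ∀ {P : Type w} [NormedAddCommGroup P] [NormedSpace ℝ P] (A : P → N) (D : Set P),
        ContMDiffOn 𝓘(ℝ, P) I ∞ A D → MapsTo A D O → ∀ y : ℝ,
        ∃ Ψ : ℝ × P → N, ContMDiffOn 𝓘(ℝ, ℝ × P) I ∞ Ψ (Ioo (y - δ) (y + δ) ×ˢ D) ∧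
          ∀ s ∈ D, Ψ (y, s) = A s ∧ ∀ t ∈ Ioo (y - δ) (y + δ), Ψ (t, s) ∈ U ∧
            HasMFDerivAt 𝓘(ℝ, ℝ) I (fun t => Ψ (t, s)) t
              ((1 : ℝ →L[ℝ] ℝ).smulRight (v (Ψ (t, s)))) := by
  have : CompleteSpace E := FiniteDimensional.complete ℝ E
  set φ := extChartAt I x₀ with hφ
  set z₀ := φ x₀ with hz₀
  let W : Set E := φ.target ∩ φ.symm ⁻¹' U
  have hWo : IsOpen W :=
    (continuousOn_extChartAt_symm x₀).isOpen_inter_preimage (isOpen_extChartAt_target x₀) hU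
  have hz₀W : z₀ ∈ W := ⟨mem_extChartAt_target x₀, by
    rw [mem_preimage, hz₀, extChartAt_to_inv]; exact hx₀⟩
  have hf := contDiffOn_fieldInChart hv x₀
  obtain ⟨r, hr, hrW⟩ := Metric.isOpen_iff.1 hWo z₀ hz₀W
  -- The flow theorem wants a field on all of `E`. The cutoff is supported in the ball of radius `r
  -- / 2`, inside `W`, and is `1` on the ball of radius `r / 4`, to which the flow is later
  -- confined.
  let χ : ContDiffBump z₀ := ⟨r / 4, r / 2, by positivity, by linarith⟩
  let f : E → E := fun z => χ z • fieldInChart I x₀ v z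
  have hfs : ContDiff ℝ ∞ f := by
    refine contMDiff_iff_contDiff.1 (contMDiff_of_tsupport fun z hz => ?_)
    have hz' : z ∈ tsupport χ := tsupport_smul_subset_left _ _ hz
    rw [χ.tsupport_eq] at hz'
    have hzW : z ∈ W := hrW (lt_of_le_of_lt (Metric.mem_closedBall.1 hz') (by
      change r / 2 < r; linarith))
    exact contMDiffAt_iff_contDiffAt.2 <| χ.contDiff.contDiffAt.smul (hf.contDiffAt (hWo.mem_nhds hzW))
  have hfeq : ∀ z ∈ Metric.ball z₀ (r / 4), f z = fieldInChart I x₀ v z := fun z hz => by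
    have : χ z = 1 := χ.one_of_mem_closedBall (Metric.ball_subset_closedBall hz)
    simp [f, this]
  obtain ⟨δ, hδ, B, hB, hzB, Φ, hΦ, hΦ0, hΦd⟩ := exists_contDiffOn_flow f hfs z₀
  have hΦc : ContinuousAt Φ (0, z₀) := (hΦ.contDiffAt (prod_mem_nhds
    (Ioo_mem_nhds (by linarith) hδ) (hB.mem_nhds hzB))).continuousAt
  have hnh : Φ ⁻¹' Metric.ball z₀ (r / 4) ∈ 𝓝 ((0 : ℝ), z₀) :=
    hΦc (by rw [hΦ0 z₀ hzB]; exact Metric.ball_mem_nhds _ (by linarith))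
  obtain ⟨δ', hδ', hball⟩ := Metric.mem_nhds_iff.1 hnh
  rw [← ball_prod_same] at hball
  have hm : min δ δ' > 0 := lt_min hδ hδ'
  have hO : IsOpen (φ.source ∩ φ ⁻¹' (B ∩ Metric.ball z₀ δ')) :=
    (continuousOn_extChartAt x₀).isOpen_inter_preimage (isOpen_extChartAt_source x₀)
      (hB.inter Metric.isOpen_ball)
  -- The length `min δ δ'` and the set of admissible initial points are fixed before the family `A`
  -- and the time `y`; the continuation argument relies on this uniformity.
  refine ⟨min δ δ', hm, _, hO, ⟨mem_extChartAt_source x₀, hzB, Metric.mem_ball_self hδ'⟩, ?_⟩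
  intro P _ _ A D hA hAD y
  have hin : ∀ t ∈ Ioo (y - min δ δ') (y + min δ δ'), ∀ s ∈ D,
      Φ (t - y, φ (A s)) ∈ Metric.ball z₀ (r / 4) := by
    intro t ht s hs
    refine hball ⟨?_, (hAD hs).2.2⟩
    have : min δ δ' ≤ δ' := min_le_right _ _
    rw [Metric.mem_ball, Real.dist_eq, sub_zero, abs_lt]
    constructor <;> linarith [ht.1, ht.2]
  have hIoo : ∀ t ∈ Ioo (y - min δ δ') (y + min δ δ'), t - y ∈ Ioo (-δ) δ := by
    intro t ht
    have : min δ δ' ≤ δ := min_le_left _ _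
    constructor <;> linarith [ht.1, ht.2]
  have hbW : Metric.ball z₀ (r / 4) ⊆ W :=
    (Metric.ball_subset_ball (by linarith)).trans hrW
  refine ⟨fun p => φ.symm (Φ (p.1 - y, φ (A p.2))), ?_, ?_⟩
  · have h1 : ContDiffOn ℝ ∞ (fun s => φ (A s)) D :=
      contMDiffOn_iff_contDiffOn.1 ((contMDiffOn_extChartAt (I := I) (n := ∞) (x := x₀)).comp hA
        fun s hs => by
          have := (hAD hs).1
          rwa [extChartAt_source] at this)
    have h2 : ContDiffOn ℝ ∞ (fun p : ℝ × P => Φ (p.1 - y, φ (A p.2)))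
        (Ioo (y - min δ δ') (y + min δ δ') ×ˢ D) :=
      hΦ.comp ((contDiff_fst.sub contDiff_const).contDiffOn.prodMk
        (h1.comp contDiff_snd.contDiffOn fun p hp => hp.2))
        fun p hp => ⟨hIoo _ hp.1, (hAD hp.2).2.1⟩
    exact (contMDiffOn_extChartAt_symm (I := I) (n := ∞) x₀).comp
      (contMDiffOn_iff_contDiffOn.2 h2) fun p hp => (hbW (hin _ hp.1 _ hp.2)).1
  · intro s hs
    refine ⟨?_, fun t ht => ⟨(hbW (hin t ht s hs)).2, ?_⟩⟩
    · simp only [sub_self]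
      rw [hΦ0 _ (hAD hs).2.1, φ.left_inv (hAD hs).1]
    · have h1 := hΦd _ (hAD hs).2.1 _ (hIoo t ht)
      rw [hfeq _ (hin t ht s hs)] at h1
      have h2 : HasDerivAt (fun t => Φ (t - y, φ (A s)))
          (fieldInChart I x₀ v (Φ (t - y, φ (A s)))) t := by
        simpa using h1.comp_sub_const t y
      exact hasMFDerivAt_of_hasDerivAt_fieldInChart (hbW (hin t ht s hs)).1 h2

omit [IsManifold I ∞ N] in
/-- Two integral curves of a vector field that is `C^1` along them coincide if they agree at one
time. -/
theorem eqOn_of_hasMFDerivAt [IsManifold I 1 N] [T2Space N] {v : (x : N) → TangentSpace I x}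
    {γ γ' : ℝ → N} {α β t₀ : ℝ} (ht₀ : t₀ ∈ Ioo α β)
    (hv : ∀ t ∈ Ioo α β,
      ContMDiffAt I I.tangent 1 (fun x => (⟨x, v x⟩ : TangentBundle I N)) (γ t))
    (hγ : ∀ t ∈ Ioo α β,
      HasMFDerivAt 𝓘(ℝ, ℝ) I γ t ((1 : ℝ →L[ℝ] ℝ).smulRight (v (γ t))))
    (hγ' : ∀ t ∈ Ioo α β,
      HasMFDerivAt 𝓘(ℝ, ℝ) I γ' t ((1 : ℝ →L[ℝ] ℝ).smulRight (v (γ' t))))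
    (h : γ t₀ = γ' t₀) : EqOn γ γ' (Ioo α β) := by
  -- Agreement and disagreement are both open conditions, by local uniqueness and the Hausdorff
  -- property; the interval is connected.
  have key : ∀ x ∈ Ioo α β, ∀ᶠ y in 𝓝[Ioo α β] x, (γ x = γ' x → γ y = γ' y) ∧
      (γ y = γ' y → γ x = γ' x) := by
    intro x hx
    have hn := Ioo_mem_nhds hx.1 hx.2
    by_cases hxe : γ x = γ' x
    · have := isMIntegralCurveAt_eventuallyEq_of_contMDiffAt_boundaryless (I := I) (hv x hx)
        (Filter.eventually_of_mem hn hγ) (Filter.eventually_of_mem hn hγ') hxe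
      filter_upwards [mem_nhdsWithin_of_mem_nhds this] with y hy
      exact ⟨fun _ => hy, fun _ => hxe⟩
    · have := (hγ x hx).continuousAt.prodMk (hγ' x hx).continuousAt |>.preimage_mem_nhds
        (isClosed_diagonal.isOpen_compl.mem_nhds hxe)
      filter_upwards [mem_nhdsWithin_of_mem_nhds this] with y hy
      exact ⟨fun h => absurd h hxe, fun h => absurd h hy⟩
  intro y hy
  exact isPreconnected_Ioo.induction₂' (fun x y => γ x = γ' x → γ y = γ' y) key
    (fun _ _ _ _ _ _ h₁ h₂ h => h₂ (h₁ h)) ht₀ hy h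

end Manifold

end SmoothFlow

/-! ### Continuation of families of integral curves over a compact time interval -/

namespace SmoothFlow

section Manifold

variable {E : Type u} [NormedAddCommGroup E] [NormedSpace ℝ E]
  {H : Type*} [TopologicalSpace H] {I : ModelWithCorners ℝ E H}
  {N : Type*} [TopologicalSpace N] [ChartedSpace H N]
  {P : Type*} [NormedAddCommGroup P] [NormedSpace ℝ P]

/-- `Ψ` is a smooth family, with parameters in `D`, of integral curves in `U` of the vector field
`v` on the time interval `(α, β)`, with values `A` at the time `a`. -/
structure IsIntegralFamily (I : ModelWithCorners ℝ E H) (v : (x : N) → TangentSpace I x)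
    (U : Set N) (A : P → N) (a α β : ℝ) (D : Set P) (Ψ : ℝ × P → N) : Prop where
  contMDiffOn : ContMDiffOn 𝓘(ℝ, ℝ × P) I ∞ Ψ (Ioo α β ×ˢ D)
  init : ∀ s ∈ D, Ψ (a, s) = A s
  mem : ∀ s ∈ D, ∀ t ∈ Ioo α β, Ψ (t, s) ∈ U
  hasMFDerivAt : ∀ s ∈ D, ∀ t ∈ Ioo α β, HasMFDerivAt 𝓘(ℝ, ℝ) I (fun t => Ψ (t, s)) t
    ((1 : ℝ →L[ℝ] ℝ).smulRight (v (Ψ (t, s))))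

theorem IsIntegralFamily.contMDiffOn_slice {v : (x : N) → TangentSpace I x}
    {U : Set N} {A : P → N} {a α β : ℝ} {D : Set P} {Ψ : ℝ × P → N}
    (h : IsIntegralFamily I v U A a α β D Ψ) {t : ℝ} (ht : t ∈ Ioo α β) :
    ContMDiffOn 𝓘(ℝ, P) I ∞ (fun s => Ψ (t, s)) D :=
  h.contMDiffOn.comp (contMDiffOn_iff_contDiffOn.2
    (contDiff_const.prodMk contDiff_id).contDiffOn) fun _ hs => ⟨ht, hs⟩

variable [I.Boundaryless] [IsManifold I ∞ N] [T2Space N]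

/-- Continuation of a smooth family of integral curves. -/
theorem IsIntegralFamily.extend {v : (x : N) → TangentSpace I x} {U : Set N} (hU : IsOpen U)
    (hv : ContMDiffOn I I.tangent ∞ (fun x => (⟨x, v x⟩ : TangentBundle I N)) U)
    {A : P → N} {a α β : ℝ} {D : Set P} {Ψ : ℝ × P → N} (hD : IsOpen D)
    (h : IsIntegralFamily I v U A a α β D Ψ) {y δ : ℝ} (hδ : 0 < δ) (hay : a ≤ y)
    (hαa : α < a) (hyβ : y < β) {Ψ₂ : ℝ × P → N}
    (h₂ : IsIntegralFamily I v U (fun s => Ψ (y, s)) y (y - δ) (y + δ) D Ψ₂) :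
    ∃ Ψ₃, IsIntegralFamily I v U A a α (y + δ) D Ψ₃ := by
  have : IsManifold I 1 N := IsManifold.of_le (n := ∞) (by simp)
  obtain ⟨m, hm, hmδ, hmα, hmβ⟩ : ∃ m > 0, m ≤ δ ∧ m ≤ y - α ∧ m ≤ β - y :=
    ⟨min δ (min (y - α) (β - y)), by
      refine lt_min hδ (lt_min ?_ ?_) <;> linarith, min_le_left _ _,
      (min_le_right _ _).trans (min_le_left _ _), (min_le_right _ _).trans (min_le_right _ _)⟩
  have hagree : ∀ s ∈ D, EqOn (fun t => Ψ (t, s)) (fun t => Ψ₂ (t, s)) (Ioo (y - m) (y + m)) := by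
    intro s hs
    have h1 : Ioo (y - m) (y + m) ⊆ Ioo α β := Ioo_subset_Ioo (by linarith) (by linarith)
    have h2 : Ioo (y - m) (y + m) ⊆ Ioo (y - δ) (y + δ) :=
      Ioo_subset_Ioo (by linarith) (by linarith)
    refine eqOn_of_hasMFDerivAt (t₀ := y) ⟨by linarith, by linarith⟩ (fun t ht => ?_)
      (fun t ht => h.hasMFDerivAt s hs t (h1 ht)) (fun t ht => h₂.hasMFDerivAt s hs t (h2 ht))
      (h₂.init s hs).symm
    exact (hv.contMDiffAt (hU.mem_nhds (h.mem s hs t (h1 ht)))).of_le (by simp)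
  -- The two families agree on `(y - m, y + m)`, so the glued family coincides near each point with
  -- one of them and inherits its properties.
  let Ψ₃ : ℝ × P → N := fun p => if p.1 < y then Ψ p else Ψ₂ p
  have hlt : ∀ p : ℝ × P, p.1 < y → Ψ₃ p = Ψ p := fun p hp => if_pos hp
  have hge : ∀ p : ℝ × P, p.1 ∈ Ioo (y - m) (y + δ) → p.2 ∈ D → Ψ₃ p = Ψ₂ p := by
    intro p hp hs
    by_cases hpy : p.1 < y
    · rw [hlt p hpy]
      exact hagree p.2 hs ⟨hp.1, by linarith⟩
    · exact if_neg hpy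
  refine ⟨Ψ₃, ?_, ?_, ?_, ?_⟩
  · rintro ⟨t, s⟩ ⟨ht, hs⟩
    refine ContMDiffAt.contMDiffWithinAt ?_
    by_cases hty : t < y
    · have h1 : ContMDiffAt 𝓘(ℝ, ℝ × P) I ∞ Ψ (t, s) :=
        h.contMDiffOn.contMDiffAt ((isOpen_Ioo.prod hD).mem_nhds ⟨⟨ht.1, hty.trans hyβ⟩, hs⟩)
      refine h1.congr_of_eventuallyEq ?_
      filter_upwards [(isOpen_Iio.prod isOpen_univ).mem_nhds
        (show (t, s) ∈ Iio y ×ˢ (univ : Set P) from ⟨hty, trivial⟩)] with p hp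
      exact hlt p hp.1
    · have h1 : ContMDiffAt 𝓘(ℝ, ℝ × P) I ∞ Ψ₂ (t, s) :=
        h₂.contMDiffOn.contMDiffAt ((isOpen_Ioo.prod hD).mem_nhds
          ⟨⟨by linarith [not_lt.1 hty], ht.2⟩, hs⟩)
      refine h1.congr_of_eventuallyEq ?_
      filter_upwards [(isOpen_Ioo.prod hD).mem_nhds
        (show (t, s) ∈ Ioo (y - m) (y + δ) ×ˢ D from
          ⟨⟨by linarith [not_lt.1 hty], ht.2⟩, hs⟩)] with p hp
      exact hge p hp.1 hp.2
  · intro s hs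
    rcases hay.lt_or_eq with h1 | h1
    · rw [hlt _ h1, h.init s hs]
    · rw [hge _ ⟨by simp only; linarith, by simp only; linarith⟩ hs]
      simp only [h1]
      rw [h₂.init s hs, ← h1, h.init s hs]
  · intro s hs t ht
    by_cases hty : t < y
    · rw [hlt _ hty]
      exact h.mem s hs t ⟨ht.1, hty.trans hyβ⟩
    · rw [hge _ ⟨by simp only; linarith [not_lt.1 hty], ht.2⟩ hs]
      exact h₂.mem s hs t ⟨by linarith [not_lt.1 hty], ht.2⟩
  · intro s hs t ht
    by_cases hty : t < y
    · rw [hlt _ hty]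
      refine (h.hasMFDerivAt s hs t ⟨ht.1, hty.trans hyβ⟩).congr_of_eventuallyEq ?_
      filter_upwards [isOpen_Iio.mem_nhds hty] with r hr using hlt _ hr
    · have hty' : t ∈ Ioo (y - m) (y + δ) := ⟨by linarith [not_lt.1 hty], ht.2⟩
      rw [hge _ hty' hs]
      refine (h₂.hasMFDerivAt s hs t ⟨by linarith [not_lt.1 hty], ht.2⟩).congr_of_eventuallyEq ?_
      filter_upwards [isOpen_Ioo.mem_nhds hty'] with r hr using hge _ hr hs

omit [I.Boundaryless] [IsManifold I ∞ N] [T2Space N] in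
theorem IsIntegralFamily.mono {v : (x : N) → TangentSpace I x} {U : Set N}
    {A : P → N} {a α β : ℝ} {D D' : Set P} {Ψ : ℝ × P → N}
    (h : IsIntegralFamily I v U A a α β D Ψ) (hD : D' ⊆ D) :
    IsIntegralFamily I v U A a α β D' Ψ :=
  ⟨h.contMDiffOn.mono (prod_mono le_rfl hD), fun s hs => h.init s (hD hs),
    fun s hs => h.mem s (hD hs), fun s hs => h.hasMFDerivAt s (hD hs)⟩

/-- A family of initial values near an initial value of an integral curve on a neighbourhood of
`[a, b]` gives rise to a smooth family of integral curves on a neighbourhood of `[a, b]`. -/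
theorem exists_isIntegralFamily [FiniteDimensional ℝ E] {v : (x : N) → TangentSpace I x}
    {U : Set N} (hU : IsOpen U)
    (hv : ContMDiffOn I I.tangent ∞ (fun x => (⟨x, v x⟩ : TangentBundle I N)) U)
    {a b a' b' : ℝ} (hab : a ≤ b) (ha' : a' < a) (hb' : b < b') {σ : ℝ → N}
    (hσU : ∀ t ∈ Ioo a' b', σ t ∈ U)
    (hσ : ∀ t ∈ Ioo a' b',
      HasMFDerivAt 𝓘(ℝ, ℝ) I σ t ((1 : ℝ →L[ℝ] ℝ).smulRight (v (σ t))))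
    {A : P → N} {D : Set P} (hD : IsOpen D) (h0 : 0 ∈ D) (hA : ContMDiffOn 𝓘(ℝ, P) I ∞ A D)
    (hA0 : A 0 = σ a) :
    ∃ (α β : ℝ) (D' : Set P) (Ψ : ℝ × P → N), α < a ∧ b < β ∧ IsOpen D' ∧ 0 ∈ D' ∧
      IsIntegralFamily I v U A a α β D' Ψ ∧ ∀ t ∈ Icc a b, Ψ (t, 0) = σ t := by
  have : IsManifold I 1 N := IsManifold.of_le (n := ∞) (by simp)
  -- Any such family has `σ` as its central curve: both are integral curves with the same value at
  -- `a`.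
  have huniq : ∀ {α β : ℝ} {D' : Set P} {Ψ : ℝ × P → N}, α < a → 0 ∈ D' →
      IsIntegralFamily I v U A a α β D' Ψ → ∀ t ∈ Icc a b, t < β → Ψ (t, 0) = σ t := by
    intro α β D' Ψ hα h0' hΨ t ht htβ
    have h1 : Ioo (max α a') (min β b') ⊆ Ioo α β :=
      Ioo_subset_Ioo (le_max_left _ _) (min_le_left _ _)
    have h2 : Ioo (max α a') (min β b') ⊆ Ioo a' b' :=
      Ioo_subset_Ioo (le_max_right _ _) (min_le_right _ _)
    refine eqOn_of_hasMFDerivAt (γ := fun t => Ψ (t, 0)) (t₀ := a)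
      ⟨max_lt hα ha', lt_min (ht.1.trans_lt htβ) (hab.trans_lt hb')⟩ (fun t ht => ?_)
      (fun t ht => hΨ.hasMFDerivAt 0 h0' t (h1 ht)) (fun t ht => hσ t (h2 ht))
      ((hΨ.init 0 h0').trans hA0)
      ⟨max_lt (hα.trans_le ht.1) (ha'.trans_le ht.1), lt_min htβ (ht.2.trans_lt hb')⟩
    exact (hv.contMDiffAt (hU.mem_nhds (hΨ.mem 0 h0' t (h1 ht)))).of_le (by simp)
  -- `Q τ` says that some family lives past time `τ`. The parameter domain may shrink at each
  -- continuation, and connectedness of `[a, b]` reduces the matter to finding a uniform step near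
  -- each time.
  let Q : ℝ → Prop := fun τ => ∃ (α β : ℝ) (D' : Set P) (Ψ : ℝ × P → N), α < a ∧ τ < β ∧
    IsOpen D' ∧ 0 ∈ D' ∧ IsIntegralFamily I v U A a α β D' Ψ
  have hin : ∀ t ∈ Icc a b, t ∈ Ioo a' b' := fun t ht =>
    ⟨ha'.trans_le ht.1, ht.2.trans_lt hb'⟩
  have hQa : Q a := by
    obtain ⟨δ, hδ, O, hO, hxO, H⟩ := exists_local_family hU hv (hσU a (hin a ⟨le_rfl, hab⟩))
    have hD' : IsOpen (D ∩ A ⁻¹' O) := hA.continuousOn.isOpen_inter_preimage hD hO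
    obtain ⟨Ψ, h1, h2⟩ := H A (D ∩ A ⁻¹' O) (hA.mono inter_subset_left) inter_subset_right a
    exact ⟨a - δ, a + δ, _, Ψ, by linarith, by linarith, hD', ⟨h0, by
      rw [mem_preimage, hA0]; exact hxO⟩, h1, fun s hs => (h2 s hs).1,
      fun s hs t ht => ((h2 s hs).2 t ht).1, fun s hs t ht => ((h2 s hs).2 t ht).2⟩
  have hmono : ∀ {y z : ℝ}, z ≤ y → Q y → Q z := by
    rintro y z hzy ⟨α, β, D', Ψ, h1, h2, h3⟩
    exact ⟨α, β, D', Ψ, h1, hzy.trans_lt h2, h3⟩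
  have key : ∀ x ∈ Icc a b, ∀ᶠ y in 𝓝[Icc a b] x, (Q x → Q y) ∧ (Q y → Q x) := by
    intro x hx
    obtain ⟨δ, hδ, O, hO, hxO, H⟩ := exists_local_family hU hv (hσU x (hin x hx))
    have step : ∀ y z, y ∈ Icc a b → σ y ∈ O → z < y + δ → Q y → Q z := by
      rintro y z hy hyO hzy ⟨α, β, D', Ψ, h1, h2, h3, h4, h5⟩
      have hyαβ : y ∈ Ioo α β := ⟨h1.trans_le hy.1, h2⟩
      have hs := h5.contMDiffOn_slice hyαβ
      have hD'' : IsOpen (D' ∩ (fun s => Ψ (y, s)) ⁻¹' O) :=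
        hs.continuousOn.isOpen_inter_preimage h3 hO
      obtain ⟨Ψ₂, h6, h7⟩ := H (fun s => Ψ (y, s)) _ (hs.mono inter_subset_left)
        inter_subset_right y
      obtain ⟨Ψ₃, h8⟩ := (h5.mono inter_subset_left).extend hU hv hD'' hδ hy.1 h1 h2
        ⟨h6, fun s hs => (h7 s hs).1, fun s hs t ht => ((h7 s hs).2 t ht).1,
          fun s hs t ht => ((h7 s hs).2 t ht).2⟩
      -- The parameter `0` survives the shrinking because the central curve is `σ` and `σ y ∈ O`.
      exact ⟨α, y + δ, _, Ψ₃, h1, hzy, hD'', ⟨h4, by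
        rw [mem_preimage, huniq h1 h4 h5 y hy h2]; exact hyO⟩, h8⟩
    have hnO : σ ⁻¹' O ∈ 𝓝 x := (hσ x (hin x hx)).continuousAt (hO.mem_nhds hxO)
    filter_upwards [self_mem_nhdsWithin, mem_nhdsWithin_of_mem_nhds hnO,
      mem_nhdsWithin_of_mem_nhds (Ioo_mem_nhds (show x - δ < x by linarith)
        (show x < x + δ by linarith))] with y hy hyO hyx
    exact ⟨step x y hx hxO hyx.2, step y x hy hyO (by linarith [hyx.1])⟩
  obtain ⟨α, β, D', Ψ, h1, h2, h3, h4, h5⟩ := isPreconnected_Icc.induction₂'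
    (fun x y => Q x → Q y) key (fun _ _ _ _ _ _ h₁ h₂ h => h₂ (h₁ h)) ⟨le_rfl, hab⟩
    ⟨hab, le_rfl⟩ hQa
  exact ⟨α, β, D', Ψ, h1, h2, h3, h4, h5, fun t ht => huniq h1 h4 h5 t ht (ht.2.trans_lt h2)⟩

end Manifold

end SmoothFlow

/-! ### The slashed tangent bundle and the spray in induced coordinates -/

namespace SprayGeometry

variable {n : ℕ} {M : Type*} [TopologicalSpace M] [ChartedSpace (EuclideanSpace ℝ (Fin n)) M]
  [IsManifold (𝓡 n) ∞ M]

/-- Vectors at the same base point are separated in a trivialization, others by their base points.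
Uniqueness of integral curves of `S` needs this, since they live in `TM`. -/
theorem t2Space_tangentBundle [T2Space M] : T2Space (TangentBundle (𝓡 n) M) := by
  refine ⟨fun v w hvw => ?_⟩
  have hπ : Continuous (fun v : TangentBundle (𝓡 n) M => v.1) :=
    FiberBundle.continuous_proj (Rn n) (TangentSpace (𝓡 n))
  by_cases h : v.1 = w.1
  · let e := trivializationAt (Rn n) (TangentSpace (𝓡 n) : M → Type) v.1
    have hv : v ∈ e.source := by simp [e]
    have hw : w ∈ e.source := by simp [e, h]
    have hne : e v ≠ e w := fun h' => hvw (e.injOn hv hw h')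
    obtain ⟨O₁, O₂, h1, h2, h3, h4, h5⟩ := t2_separation hne
    exact ⟨e.source ∩ e ⁻¹' O₁, e.source ∩ e ⁻¹' O₂,
      e.continuousOn_toFun.isOpen_inter_preimage e.open_source h1,
      e.continuousOn_toFun.isOpen_inter_preimage e.open_source h2, ⟨hv, h3⟩, ⟨hw, h4⟩,
      (h5.preimage e).mono inter_subset_right inter_subset_right⟩
  · obtain ⟨O₁, O₂, h1, h2, h3, h4, h5⟩ := t2_separation h
    exact ⟨_, _, h1.preimage hπ, h2.preimage hπ, h3, h4, h5.preimage _⟩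

theorem tangentChart_apply (p : M) (v : TangentBundle (𝓡 n) M) :
    tangentChart p v = (extChartAt (𝓡 n) p v.1, tangentCoordChange (𝓡 n) v.1 p v.1 v.2) := rfl

theorem mem_tangentChart_source {p : M} {v : TangentBundle (𝓡 n) M} :
    v ∈ (tangentChart (n := n) p).source ↔ v.1 ∈ (chartAt (Rn n) p).source := by
  rw [tangentChart, extChartAt_source, TangentBundle.mem_chart_source_iff]

theorem mem_tangentChart_target {p : M} {z : Rn n × Rn n} :
    z ∈ (tangentChart (M := M) p).target ↔ z.1 ∈ (extChartAt (𝓡 n) p).target := by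
  constructor
  · intro hz
    have h1 := mem_tangentChart_source.1 ((tangentChart (M := M) p).map_target hz)
    have h2 := congrArg Prod.fst ((tangentChart (M := M) p).right_inv hz)
    rw [tangentChart_apply] at h2
    rw [← h2]
    exact (extChartAt (𝓡 n) p).map_source (by rwa [extChartAt_source])
  · intro hz
    rw [extChartAt_target] at hz
    rw [tangentChart, extChartAt_target]
    exact ⟨(TangentBundle.mem_chart_target_iff _ _).2 hz.1, by
      rw [ModelWithCorners.range_eq_univ]; trivial⟩

theorem tangentCoordChange_tangentCoordChange {p q r : M} (hp : r ∈ (chartAt (Rn n) p).source)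
    (hq : r ∈ (chartAt (Rn n) q).source) (w : Rn n) :
    tangentCoordChange (𝓡 n) q p r (tangentCoordChange (𝓡 n) p q r w) = w :=
  (tangentCoordChange_comp ⟨⟨by rwa [extChartAt_source], by rwa [extChartAt_source]⟩,
    by rwa [extChartAt_source]⟩).trans (tangentCoordChange_self (by rwa [extChartAt_source]))

theorem tangentChart_snd_ne_zero_iff {p : M} {v : TangentBundle (𝓡 n) M}
    (hv : v.1 ∈ (chartAt (Rn n) p).source) : (tangentChart p v).2 ≠ 0 ↔ v ∈ slashed := by
  rw [tangentChart_apply]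
  refine not_congr ⟨fun h => ?_, fun h => ?_⟩
  · have := tangentCoordChange_tangentCoordChange (mem_chart_source (Rn n) v.1) hv v.2
    simp only at h
    rw [h, map_zero] at this
    exact this.symm
  · simp only
    rw [h]
    exact map_zero (tangentCoordChange (𝓡 n) v.1 p v.1)

theorem isOpen_slashed : IsOpen (slashed : Set (TangentBundle (𝓡 n) M)) := by
  rw [isOpen_iff_mem_nhds]
  intro v hv
  have h1 : ContinuousOn (tangentChart v.1) (tangentChart (n := n) v.1).source :=
    continuousOn_extChartAt _
  have h2 := h1.isOpen_inter_preimage (isOpen_extChartAt_source _)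
    ((isOpen_compl_singleton (x := (0 : Rn n))).preimage continuous_snd)
  have hvs : v.1 ∈ (chartAt (Rn n) v.1).source := mem_chart_source _ _
  refine Filter.mem_of_superset (h2.mem_nhds ⟨mem_tangentChart_source.2 hvs,
    (tangentChart_snd_ne_zero_iff hvs).2 hv⟩) fun w hw => ?_
  exact (tangentChart_snd_ne_zero_iff (mem_tangentChart_source.1 hw.1)).1 hw.2

variable {S : (v : TangentBundle (𝓡 n) M) → TangentSpace (𝓡 n).tangent v}

theorem mdifferentiableAt_tangentChart {p : M} {v : TangentBundle (𝓡 n) M}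
    (hv : v.1 ∈ (chartAt (Rn n) p).source) :
    MDifferentiableAt (𝓡 n).tangent 𝓘(ℝ, Rn n × Rn n) (tangentChart (n := n) p) v :=
  mdifferentiableAt_extChartAt (mem_chart_source_tangent hv)
where
  mem_chart_source_tangent {p : M} {v : TangentBundle (𝓡 n) M}
    (hv : v.1 ∈ (chartAt (Rn n) p).source) :
    v ∈ (chartAt (ModelProd (Rn n) (Rn n)) (⟨p, 0⟩ : TangentBundle (𝓡 n) M)).source :=
    (TangentBundle.mem_chart_source_iff _ _).2 hv

/-- The spray reads `(x, y) ↦ (y, -2 G(x, y))` in local coordinates. -/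
theorem mfderiv_tangentChart_spray (hS : IsSpray S) {p : M} {v : TangentBundle (𝓡 n) M}
    (hv : v.1 ∈ (chartAt (Rn n) p).source) (hvs : v ∈ slashed) :
    (mfderiv (𝓡 n).tangent 𝓘(ℝ, Rn n × Rn n) (tangentChart (n := n) p) v (S v) : Rn n × Rn n) =
      ((tangentChart p v).2, (-2 : ℝ) • sprayCoeff S p (tangentChart p v)) := by
  have hsrc := mem_tangentChart_source.2 hv
  refine Prod.ext ?_ ?_
  · have h1 := mdifferentiableAt_tangentChart hv
    -- The first component of the chart of `TM` is the chart of `M` composed with `π`. The chain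
    -- rule and `Dπ ∘ S = id` give the first half.
    have h2 : HasMFDerivAt (𝓡 n).tangent 𝓘(ℝ, Rn n)
        (fun w : TangentBundle (𝓡 n) M => (tangentChart p w).1) v
        ((ContinuousLinearMap.fst ℝ (Rn n) (Rn n)).comp (mfderiv (𝓡 n).tangent
          𝓘(ℝ, Rn n × Rn n) (tangentChart (n := n) p) v)) :=
      HasMFDerivAt.comp v (ContinuousLinearMap.fst ℝ (Rn n) (Rn n)).hasMFDerivAt h1.hasMFDerivAt
    have h3 : MDifferentiableAt (𝓡 n).tangent (𝓡 n) (fun w : TangentBundle (𝓡 n) M => w.1) v :=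
      (Bundle.contMDiff_proj (TangentSpace (𝓡 n) : M → Type) (n := 1)).mdifferentiableAt (by simp)
    have h4 := HasMFDerivAt.comp v (mdifferentiableAt_extChartAt (I := 𝓡 n) hv).hasMFDerivAt
      h3.hasMFDerivAt
    have h5 := hasMFDerivAt_unique h2 h4
    have h6 := congrArg (fun L => L (S v)) h5
    refine Eq.trans h6 ?_
    have h7 := hS.semispray v hvs
    have h8 : (mfderiv (𝓡 n) 𝓘(ℝ, Rn n) (extChartAt (𝓡 n) p) v.1 v.2 : Rn n) =
      tangentCoordChange (𝓡 n) v.1 p v.1 v.2 := by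
      exact congrArg (fun L => L v.2) (mfderiv_chartAt_eq_tangentCoordChange (I := 𝓡 n) hv)
    refine Eq.trans ?_ h8
    exact congrArg (mfderiv (𝓡 n) 𝓘(ℝ, Rn n) (extChartAt (𝓡 n) p) v.1) h7
  · simp only [sprayCoeff]
    rw [(tangentChart p).left_inv hsrc, smul_smul]
    norm_num

/-- The derivative of a chart is a tangent coordinate change, so smoothness of `S` as a section
passes to its coefficients. -/
theorem sprayCoeff_eq {p : M} {z : Rn n × Rn n} (hz : z.1 ∈ (extChartAt (𝓡 n) p).target) :
    sprayCoeff S p z = (-(1 / 2) : ℝ) •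
      (SmoothFlow.fieldInChart (𝓡 n).tangent (⟨p, 0⟩ : TangentBundle (𝓡 n) M) S z).2 := by
  have h1 := (tangentChart p).map_target (mem_tangentChart_target (M := M).2 hz)
  rw [tangentChart, extChartAt_source] at h1
  simp only [sprayCoeff, SmoothFlow.fieldInChart]
  rw [← mfderiv_chartAt_eq_tangentCoordChange h1]
  rfl

/-- The set of coordinates `(x, y)` of nonzero vectors in the chart at `p`. -/
def coordDomain (n : ℕ) {M : Type*} [TopologicalSpace M]
    [ChartedSpace (EuclideanSpace ℝ (Fin n)) M] (p : M) : Set (Rn n × Rn n) :=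
  (extChartAt (𝓡 n) p).target ×ˢ {0}ᶜ

omit [IsManifold (𝓡 n) ∞ M] in
theorem isOpen_coordDomain (p : M) : IsOpen (coordDomain n p) :=
  (isOpen_extChartAt_target p).prod isOpen_compl_singleton

theorem tangentChart_mem_coordDomain {p : M} {v : TangentBundle (𝓡 n) M}
    (hv : v.1 ∈ (chartAt (Rn n) p).source) (hvs : v ∈ slashed) :
    tangentChart p v ∈ coordDomain n p := by
  refine ⟨?_, (tangentChart_snd_ne_zero_iff hv).2 hvs⟩
  exact mem_tangentChart_target.1 ((tangentChart p).map_source (mem_tangentChart_source.2 hv))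

theorem contDiffOn_sprayCoeff (hS : IsSpray S) (p : M) :
    ContDiffOn ℝ ∞ (sprayCoeff S p) (coordDomain n p) := by
  have h1 := SmoothFlow.contDiffOn_fieldInChart hS.smooth (⟨p, 0⟩ : TangentBundle (𝓡 n) M)
  have h2 : ContDiffOn ℝ ∞ (fun z => (-(1 / 2) : ℝ) •
      (SmoothFlow.fieldInChart (𝓡 n).tangent (⟨p, 0⟩ : TangentBundle (𝓡 n) M) S z).2)
      (coordDomain n p) := by
    refine ContDiffOn.const_smul _ (h1.mono fun z hz => ?_).snd
    have hz' := mem_tangentChart_target.2 hz.1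
    refine ⟨hz', ?_⟩
    have h3 := (tangentChart p).map_target hz'
    refine (tangentChart_snd_ne_zero_iff (mem_tangentChart_source.1 h3)).1 ?_
    rw [(tangentChart p).right_inv hz']
    exact hz.2
  exact h2.congr fun z hz => sprayCoeff_eq hz.1

end SprayGeometry

namespace SprayGeometry

variable {n : ℕ} {M : Type*} [TopologicalSpace M] [ChartedSpace (EuclideanSpace ℝ (Fin n)) M]
  [IsManifold (𝓡 n) ∞ M]
  {S : (v : TangentBundle (𝓡 n) M) → TangentSpace (𝓡 n).tangent v}

/-! ### Geodesics and integral curves -/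

/-- By `Dπ ∘ S = id` an integral curve of `S` is the velocity of its own projection; geodesics and
integral curves are therefore interchangeable. -/
theorem tangentWithin_proj_of_hasMFDerivAt (hS : IsSpray S) {σ : ℝ → TangentBundle (𝓡 n) M}
    {s : Set ℝ} (hs : IsOpen s) (hmem : ∀ t ∈ s, σ t ∈ slashed)
    (h : ∀ t ∈ s, HasMFDerivAt 𝓘(ℝ, ℝ) (𝓡 n).tangent σ t
      ((1 : ℝ →L[ℝ] ℝ).smulRight (S (σ t)))) {t : ℝ} (ht : t ∈ s) :
    tangentWithin (fun t => (σ t).1) s t = σ t := by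
  have h3 : MDifferentiableAt (𝓡 n).tangent (𝓡 n) (fun w : TangentBundle (𝓡 n) M => w.1) (σ t) :=
    (Bundle.contMDiff_proj (TangentSpace (𝓡 n) : M → Type) (n := 1)).mdifferentiableAt (by simp)
  have h4 := HasMFDerivAt.comp t h3.hasMFDerivAt (h t ht)
  have h5 : mfderivWithin 𝓘(ℝ, ℝ) (𝓡 n) (fun t => (σ t).1) s t (1 : ℝ) = (σ t).2 := by
    rw [mfderivWithin_of_isOpen hs ht]
    refine (congrArg (fun L => L (1 : ℝ)) h4.mfderiv).trans ?_
    refine Eq.trans ?_ (hS.semispray (σ t) (hmem t ht))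
    refine congrArg (mfderiv (𝓡 n).tangent (𝓡 n) (fun w : TangentBundle (𝓡 n) M => w.1) (σ t)) ?_
    exact one_smul ℝ (S (σ t))
  simp only [tangentWithin]
  rw [h5]

theorem isGeodesicOnOpen_proj (hS : IsSpray S) {σ : ℝ → TangentBundle (𝓡 n) M}
    {s : Set ℝ} (hs : IsOpen s) (hmem : ∀ t ∈ s, σ t ∈ slashed)
    (hσ : ContMDiffOn 𝓘(ℝ, ℝ) (𝓡 n).tangent ∞ σ s)
    (h : ∀ t ∈ s, HasMFDerivAt 𝓘(ℝ, ℝ) (𝓡 n).tangent σ t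
      ((1 : ℝ →L[ℝ] ℝ).smulRight (S (σ t)))) :
    IsGeodesicOnOpen S (fun t => (σ t).1) s := by
  have key : EqOn (tangentWithin (fun t => (σ t).1) s) σ s := fun t ht =>
    tangentWithin_proj_of_hasMFDerivAt hS hs hmem h ht
  refine ⟨(Bundle.contMDiff_proj (TangentSpace (𝓡 n) : M → Type)).comp_contMDiffOn hσ,
    fun t ht => by rw [key ht]; exact hmem t ht, fun t ht => ?_⟩
  have h0 : HasMFDerivWithinAt 𝓘(ℝ, ℝ) (𝓡 n).tangent σ s t
      ((1 : ℝ →L[ℝ] ℝ).smulRight (S (σ t))) := (h t ht).hasMFDerivWithinAt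
  have h1 := h0.congr_of_eventuallyEq
    (Filter.eventually_of_mem self_mem_nhdsWithin fun r hr => key hr) (key ht)
  have h2 : mfderivWithin 𝓘(ℝ, ℝ) (𝓡 n).tangent
      (tangentWithin (n := n) (fun t => (σ t).1) s) s t (1 : ℝ) = S (σ t) := by
    refine (congrArg (fun L => L (1 : ℝ)) (h1.mfderivWithin (hs.uniqueMDiffWithinAt ht))).trans ?_
    exact one_smul ℝ (S (σ t))
  refine Eq.trans h2 ?_
  rw [key ht]

/-- The velocity curve is the tangent map of `γ` applied to the constant field `1` on `ℝ`. -/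
theorem contMDiffOn_tangentWithin {γ : ℝ → M} {s : Set ℝ} (hs : IsOpen s)
    (hγ : ContMDiffOn 𝓘(ℝ, ℝ) (𝓡 n) ∞ γ s) :
    ContMDiffOn 𝓘(ℝ, ℝ) (𝓡 n).tangent ∞ (tangentWithin (n := n) γ s) s := by
  have h1 := hγ.contMDiffOn_tangentMapWithin (m := ∞) (by simp) hs.uniqueMDiffOn
  have h2 : ContMDiff 𝓘(ℝ, ℝ) 𝓘(ℝ, ℝ).tangent ∞
      (fun t : ℝ => (⟨t, (1 : ℝ)⟩ : TangentBundle 𝓘(ℝ, ℝ) ℝ)) :=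
    contMDiff_vectorSpace_iff_contDiff.2 contDiff_const
  exact h1.comp h2.contMDiffOn fun t ht => ht

theorem IsGeodesicOnOpen.hasMFDerivAt {γ : ℝ → M} {s : Set ℝ} (hs : IsOpen s)
    (h : IsGeodesicOnOpen S γ s) {t : ℝ} (ht : t ∈ s) :
    HasMFDerivAt 𝓘(ℝ, ℝ) (𝓡 n).tangent (tangentWithin (n := n) γ s) t
      ((1 : ℝ →L[ℝ] ℝ).smulRight (S (tangentWithin γ s t))) := by
  have h1 := ((contMDiffOn_tangentWithin hs h.smooth).contMDiffAt
    (hs.mem_nhds ht)).mdifferentiableAt (by simp)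
  have h2 := h.geodesic t ht
  rw [mfderivWithin_of_isOpen hs ht] at h2
  refine h1.hasMFDerivAt.congr_mfderiv ?_
  refine ContinuousLinearMap.ext_ring ?_
  exact h2.trans (one_smul ℝ (S (tangentWithin γ s t))).symm

/-- The spray in the coordinates `(x, y)` of the chart at `p`. -/
noncomputable def sprayField (S : (v : TangentBundle (𝓡 n) M) → TangentSpace (𝓡 n).tangent v) (p : M)
    (z : Rn n × Rn n) : Rn n × Rn n := (z.2, (-2 : ℝ) • sprayCoeff S p z)

theorem hasDerivAt_tangentChart (hS : IsSpray S) {σ : ℝ → TangentBundle (𝓡 n) M} {p : M} {t : ℝ}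
    (hp : (σ t).1 ∈ (chartAt (Rn n) p).source) (hmem : σ t ∈ slashed)
    (h : HasMFDerivAt 𝓘(ℝ, ℝ) (𝓡 n).tangent σ t ((1 : ℝ →L[ℝ] ℝ).smulRight (S (σ t)))) :
    HasDerivAt (fun t => tangentChart p (σ t)) (sprayField S p (tangentChart p (σ t))) t := by
  have h1 := HasMFDerivAt.comp t (mdifferentiableAt_tangentChart hp).hasMFDerivAt h
  let D : ℝ →L[ℝ] Rn n × Rn n :=
    (mfderiv (𝓡 n).tangent 𝓘(ℝ, Rn n × Rn n) (tangentChart (n := n) p) (σ t)).comp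
      ((1 : ℝ →L[ℝ] ℝ).smulRight (S (σ t)))
  have h2 : HasDerivAt (fun t => tangentChart p (σ t)) (D 1) t :=
    HasFDerivAt.hasDerivAt (hasMFDerivAt_iff_hasFDerivAt.1 h1)
  refine h2.congr_deriv (Eq.trans ?_ (mfderiv_tangentChart_spray hS hp hmem))
  refine congrArg (mfderiv (𝓡 n).tangent 𝓘(ℝ, Rn n × Rn n) (tangentChart (n := n) p) (σ t)) ?_
  exact one_smul ℝ (S (σ t))

/-! ### Linearised equations -/

theorem contDiffAt_sprayCoeff (hS : IsSpray S) {p : M} {z : Rn n × Rn n}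
    (hz : z ∈ coordDomain n p) : ContDiffAt ℝ ∞ (sprayCoeff S p) z :=
  (contDiffOn_sprayCoeff hS p).contDiffAt ((isOpen_coordDomain p).mem_nhds hz)

theorem nonlinConn_eq (hS : IsSpray S) {p : M} {z : Rn n × Rn n}
    (hz : z ∈ coordDomain n p) :
    nonlinConn S p z = fderiv ℝ (sprayCoeff S p) z ∘L .inr ℝ (Rn n) (Rn n) := by
  have h1 := ((contDiffAt_sprayCoeff hS hz).differentiableAt (by simp)).hasFDerivAt
  exact (HasFDerivAt.comp z.2 (f := fun y : Rn n => (z.1, y)) h1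
    (hasFDerivAt_prodMk_right z.1 z.2)).fderiv

theorem fderiv_sprayCoeff_fst (hS : IsSpray S) {p : M} {z : Rn n × Rn n}
    (hz : z ∈ coordDomain n p) :
    fderiv ℝ (fun x : Rn n => sprayCoeff S p (x, z.2)) z.1 =
      fderiv ℝ (sprayCoeff S p) z ∘L .inl ℝ (Rn n) (Rn n) := by
  have h1 := ((contDiffAt_sprayCoeff hS hz).differentiableAt (by simp)).hasFDerivAt
  exact (HasFDerivAt.comp z.1 (f := fun x : Rn n => (x, z.2)) h1
    (hasFDerivAt_prodMk_left z.1 z.2)).fderiv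

theorem differentiableAt_nonlinConn (hS : IsSpray S) {p : M} {z : Rn n × Rn n}
    (hz : z ∈ coordDomain n p) : DifferentiableAt ℝ (nonlinConn S p) z := by
  have h1 : DifferentiableAt ℝ (fderiv ℝ (sprayCoeff S p)) z :=
    ((contDiffAt_sprayCoeff hS hz).fderiv_right (m := 1) (by norm_cast)).differentiableAt
      (by simp)
  have h2 : DifferentiableAt ℝ
      (fun z => fderiv ℝ (sprayCoeff S p) z ∘L .inr ℝ (Rn n) (Rn n)) z :=
    h1.clm_comp (differentiableAt_const _)
  refine h2.congr_of_eventuallyEq ?_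
  filter_upwards [(isOpen_coordDomain p).mem_nhds hz] with w hw using nonlinConn_eq hS hw

theorem contDiffOn_sprayField (hS : IsSpray S) (p : M) :
    ContDiffOn ℝ ∞ (sprayField S p) (coordDomain n p) :=
  contDiff_snd.contDiffOn.prodMk ((contDiffOn_sprayCoeff hS p).const_smul _)

/-- This is the linearised geodesic equation, expressed through the partial derivatives of `G` that
enter `∇` and `Φ`. -/
theorem fderiv_sprayField (hS : IsSpray S) {p : M} {z : Rn n × Rn n}
    (hz : z ∈ coordDomain n p) (w : Rn n × Rn n) :
    fderiv ℝ (sprayField S p) z w = (w.2, (-2 : ℝ) •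
      (fderiv ℝ (fun x : Rn n => sprayCoeff S p (x, z.2)) z.1 w.1 + nonlinConn S p z w.2)) := by
  have h1 := ((contDiffAt_sprayCoeff hS hz).differentiableAt (by simp)).hasFDerivAt
  have h2 : HasFDerivAt (sprayField S p) ((ContinuousLinearMap.snd ℝ (Rn n) (Rn n)).prod
      ((-2 : ℝ) • fderiv ℝ (sprayCoeff S p) z)) z := hasFDerivAt_snd.prodMk (h1.fun_const_smul _)
  rw [h2.fderiv, fderiv_sprayCoeff_fst hS hz, nonlinConn_eq hS hz]
  refine Prod.ext rfl ?_
  simp only [ContinuousLinearMap.prod_apply, smul_apply,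
    ContinuousLinearMap.comp_apply, ContinuousLinearMap.inl_apply, ContinuousLinearMap.inr_apply]
  rw [← map_add]
  simp

/-- The variation of a family of solutions of an autonomous ODE solves the linearised equation. -/
theorem hasDerivAt_fderiv_family {P X : Type*} [NormedAddCommGroup P] [NormedSpace ℝ P]
    [NormedAddCommGroup X] [NormedSpace ℝ X] {z : ℝ × P → X} {F : X → X} {Ω : Set (ℝ × P)}
    (hΩ : IsOpen Ω) (hz : ContDiffOn ℝ ∞ z Ω)
    (h : ∀ q ∈ Ω, HasDerivAt (fun t => z (t, q.2)) (F (z q)) q.1) {t : ℝ} {s : P}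
    (hts : (t, s) ∈ Ω) (hF : DifferentiableAt ℝ F (z (t, s))) (e : P) :
    HasDerivAt (fun t => fderiv ℝ z (t, s) (0, e))
      (fderiv ℝ F (z (t, s)) (fderiv ℝ z (t, s) (0, e))) t := by
  have hzt : ContDiffAt ℝ ∞ z (t, s) := hz.contDiffAt (hΩ.mem_nhds hts)
  have hD : HasFDerivAt (fderiv ℝ z) (fderiv ℝ (fderiv ℝ z) (t, s)) (t, s) :=
    ((hzt.fderiv_right (m := 1) (by norm_cast)).differentiableAt (by simp)).hasFDerivAt
  have hsymm : IsSymmSndFDerivAt ℝ z (t, s) := hzt.isSymmSndFDerivAt (by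
    rw [minSmoothness_of_isRCLikeNormedField]; exact WithTop.coe_le_coe.2 (le_top : (2 : ℕ∞) ≤ ⊤))
  have h1 : HasDerivAt (fun t => fderiv ℝ z (t, s) (0, e))
      (fderiv ℝ (fderiv ℝ z) (t, s) (1, 0) (0, e)) t := by
    have h2 : HasDerivAt (fun t : ℝ => (t, s)) ((1 : ℝ), (0 : P)) t :=
      (hasDerivAt_id t).prodMk (hasDerivAt_const t s)
    have h3 := hD.comp_hasDerivAt t h2
    simpa using h3.clm_apply (hasDerivAt_const t ((0 : ℝ), e))
  refine h1.congr_deriv ?_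
  -- Exchanging the order of the derivatives leaves the `s`-derivative of `∂ₜz`, which equals `F ∘
  -- z` near `(t, s)`.
  rw [hsymm.eq (1, 0) (0, e)]
  have h4 : (fun q => fderiv ℝ z q (1, 0)) =ᶠ[𝓝 (t, s)] fun q => F (z q) := by
    filter_upwards [hΩ.mem_nhds hts] with q hq
    have h5 := ((hz.contDiffAt (hΩ.mem_nhds hq)).differentiableAt (by simp)).hasFDerivAt
    have h2 : HasDerivAt (fun t : ℝ => (t, q.2)) ((1 : ℝ), (0 : P)) q.1 :=
      (hasDerivAt_id q.1).prodMk (hasDerivAt_const q.1 q.2)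
    exact (h5.comp_hasDerivAt q.1 h2).unique (h q hq)
  have h6 : HasFDerivAt (fun q => fderiv ℝ z q (1, 0))
      (fderiv ℝ F (z (t, s)) ∘L fderiv ℝ z (t, s)) (t, s) :=
    (hF.hasFDerivAt.comp (t, s) (hzt.differentiableAt (by simp)).hasFDerivAt).congr_of_eventuallyEq
      h4
  have h7 := hD.clm_apply (hasFDerivAt_const ((1 : ℝ), (0 : P)) (t, s))
  have h8 := congrArg (fun L => L (0, e)) (h7.unique h6)
  simpa using h8

/-- A solution of a linear ODE that vanishes at one time vanishes identically. -/
theorem eqOn_zero_of_linear_ode {X : Type*} [NormedAddCommGroup X] [NormedSpace ℝ X]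
    {L : ℝ → X →L[ℝ] X} {W : ℝ → X} {α β t₀ : ℝ} (hL : ContinuousOn L (Icc α β))
    (hW : ∀ t ∈ Icc α β, HasDerivWithinAt W (L t (W t)) (Icc α β) t)
    (ht₀ : t₀ ∈ Icc α β) (h : W t₀ = 0) : ∀ t ∈ Icc α β, W t = 0 := by
  obtain ⟨C, hC⟩ := isCompact_Icc.exists_bound_of_continuousOn hL
  have hlip : ∀ t ∈ Icc α β, LipschitzOnWith (Real.toNNReal C) (fun x => L t x) univ := by
    intro t ht
    refine LipschitzOnWith.of_dist_le_mul fun x _ y _ => ?_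
    rw [dist_eq_norm, dist_eq_norm, ← map_sub]
    refine ((L t).le_opNorm _).trans (mul_le_mul_of_nonneg_right ?_ (norm_nonneg _))
    exact (hC t ht).trans (Real.le_coe_toNNReal C)
  have hc : ContinuousOn W (Icc α β) := fun t ht => (hW t ht).continuousWithinAt
  have h0 : ∀ (s : Set ℝ) (t : ℝ), HasDerivWithinAt (fun _ : ℝ => (0 : X)) (L t 0) s t := by
    intro s t
    rw [map_zero]
    exact hasDerivWithinAt_const t s 0
  intro t ht
  rcases le_total t₀ t with htt | htt
  · have hsub : Icc t₀ β ⊆ Icc α β := Icc_subset_Icc_left ht₀.1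
    refine ODE_solution_unique_of_mem_Icc_right (v := fun t x => L t x) (s := fun _ => univ)
      (K := Real.toNNReal C) (fun r hr => hlip r (hsub ⟨hr.1, hr.2.le⟩)) (hc.mono hsub) (fun r hr => ?_)
      (fun _ _ => trivial) (continuousOn_const (c := (0 : X))) (fun r _ => h0 _ r) (fun _ _ => trivial) h
      ⟨htt, ht.2⟩
    refine (hW r (hsub ⟨hr.1, hr.2.le⟩)).mono_of_mem_nhdsWithin ?_
    exact Filter.mem_of_superset (Icc_mem_nhdsGE_of_mem ⟨le_rfl, hr.2⟩)
      (Icc_subset_Icc_left (ht₀.1.trans hr.1))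
  · have hsub : Icc α t₀ ⊆ Icc α β := Icc_subset_Icc_right ht₀.2
    refine ODE_solution_unique_of_mem_Icc_left (v := fun t x => L t x) (s := fun _ => univ)
      (K := Real.toNNReal C) (fun r hr => hlip r (hsub ⟨hr.1.le, hr.2⟩)) (hc.mono hsub) (fun r hr => ?_)
      (fun _ _ => trivial) (continuousOn_const (c := (0 : X))) (fun r _ => h0 _ r) (fun _ _ => trivial) h
      ⟨ht.1, htt⟩
    refine (hW r (hsub ⟨hr.1.le, hr.2⟩)).mono_of_mem_nhdsWithin ?_
    exact Filter.mem_of_superset (Icc_mem_nhdsLE_of_mem ⟨hr.1, le_rfl⟩)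
      (Icc_subset_Icc_right (hr.2.trans ht₀.2))

end SprayGeometry

namespace SprayGeometry

variable {n : ℕ} {M : Type*} [TopologicalSpace M] [ChartedSpace (EuclideanSpace ℝ (Fin n)) M]
  [IsManifold (𝓡 n) ∞ M]
  {S : (v : TangentBundle (𝓡 n) M) → TangentSpace (𝓡 n).tangent v}

/-! ### Tensors along a curve in local coordinates -/

theorem vecComp_change {c : ℝ → M} {p q : M} {X : (t : ℝ) → TangentSpace (𝓡 n) (c t)} {t : ℝ}
    (hp : c t ∈ (chartAt (Rn n) p).source) (hq : c t ∈ (chartAt (Rn n) q).source) :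
    tangentCoordChange (𝓡 n) p q (c t) (vecComp c p X t) = vecComp c q X t :=
  tangentCoordChange_comp ⟨⟨mem_extChartAt_source (I := 𝓡 n) (c t),
    by rwa [extChartAt_source]⟩, by rwa [extChartAt_source]⟩

theorem endoComp_vecComp {c : ℝ → M} {p : M}
    {J : (t : ℝ) → TangentSpace (𝓡 n) (c t) →L[ℝ] TangentSpace (𝓡 n) (c t)}
    {X : (t : ℝ) → TangentSpace (𝓡 n) (c t)} {t : ℝ} (hp : c t ∈ (chartAt (Rn n) p).source) :
    endoComp c p J t (vecComp c p X t) = vecComp c p (fun t => J t (X t)) t := by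
  have h := tangentCoordChange_tangentCoordChange (mem_chart_source (Rn n) (c t)) hp (X t)
  exact congrArg (fun w => tangentCoordChange (𝓡 n) (c t) p (c t) (J t w)) h

omit [IsManifold (𝓡 n) ∞ M] in
theorem chartTimes_mem_nhdsWithin {c : ℝ → M} {s : Set ℝ} {p : M} (hc : ContinuousOn c s) {t : ℝ}
    (ht : t ∈ chartTimes (n := n) c s p) : chartTimes (n := n) c s p ∈ 𝓝[s] t :=
  Filter.inter_mem self_mem_nhdsWithin
    ((hc t ht.1) ((chartAt (Rn n) p).open_source.mem_nhds ht.2))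

theorem hasDerivWithinAt_vecComp {c : ℝ → M} {s : Set ℝ} {p : M} (hc : ContinuousOn c s) {t : ℝ}
    (ht : t ∈ chartTimes (n := n) c s p) {e : (t : ℝ) → TangentSpace (𝓡 n) (c t)}
    (he : IsParallel S c s e) :
    HasDerivWithinAt (vecComp c p e)
      (-(nonlinConn S p (tangentCoord c s p t) (vecComp c p e t))) s t := by
  have h1 : ContDiffWithinAt ℝ ∞ (vecComp c p e) s t :=
    (he.smooth p t ht).mono_of_mem_nhdsWithin (chartTimes_mem_nhdsWithin hc ht)
  have h2 := (h1.differentiableWithinAt (by simp)).hasDerivWithinAt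
  rwa [eq_neg_of_add_eq_zero_left (he.parallel p t ht)] at h2

/-- The images of parallel fields under a Jacobi tensor solve the linearised geodesic equation. -/
theorem hasDerivWithinAt_jacobi (hS : IsSpray S) {c : ℝ → M} {s : Set ℝ} {p : M}
    (hs : UniqueDiffOn ℝ s) (hc : ContinuousOn c s) {t : ℝ}
    (ht : t ∈ chartTimes (n := n) c s p)
    (hz : HasDerivWithinAt (tangentCoord c s p) (sprayField S p (tangentCoord c s p t)) s t)
    (hzd : tangentCoord c s p t ∈ coordDomain n p)
    {J : (t : ℝ) → TangentSpace (𝓡 n) (c t) →L[ℝ] TangentSpace (𝓡 n) (c t)}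
    (hJ : IsJacobiTensor S c s J) {e : (t : ℝ) → TangentSpace (𝓡 n) (c t)}
    (he : IsParallel S c s e) :
    HasDerivWithinAt
      (fun t => (endoComp c p J t (vecComp c p e t),
        covDerivEndo S c s p (endoComp c p J) t (vecComp c p e t) -
          nonlinConn S p (tangentCoord c s p t) (endoComp c p J t (vecComp c p e t))))
      (fderiv ℝ (sprayField S p) (tangentCoord c s p t)
        (endoComp c p J t (vecComp c p e t),
          covDerivEndo S c s p (endoComp c p J) t (vecComp c p e t) -
            nonlinConn S p (tangentCoord c s p t) (endoComp c p J t (vecComp c p e t)))) s t := by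
  set A := endoComp c p J with hA
  set B := covDerivEndo S c s p A with hB
  set X := vecComp c p e with hX
  set z := tangentCoord (n := n) c s p with hzdef
  have hAt : ContDiffWithinAt ℝ ∞ A s t :=
    (hJ.smooth p t ht).mono_of_mem_nhdsWithin (chartTimes_mem_nhdsWithin hc ht)
  have hA1 : HasDerivWithinAt A (derivWithin A s t) s t :=
    (hAt.differentiableWithinAt (by simp)).hasDerivWithinAt
  have hX1 : HasDerivWithinAt X (-(nonlinConn S p (z t) (X t))) s t :=
    hasDerivWithinAt_vecComp hc ht he
  have hN : HasDerivWithinAt (fun t => nonlinConn S p (z t))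
      (fderiv ℝ (nonlinConn S p) (z t) (sprayField S p (z t))) s t :=
    (differentiableAt_nonlinConn hS hzd).hasFDerivAt.comp_hasDerivWithinAt t hz
  have hA2 : DifferentiableWithinAt ℝ (derivWithin A s) s t := by
    have h1 := (hAt.fderivWithin_right (m := 1) hs (by norm_cast) ht.1).differentiableWithinAt
      (by simp)
    exact h1.clm_apply (differentiableWithinAt_const (1 : ℝ))
  have hB1 : HasDerivWithinAt B (derivWithin B s t) s t :=
    ((hA2.add (hN.differentiableWithinAt.clm_comp hA1.differentiableWithinAt)).sub
      (hA1.differentiableWithinAt.clm_comp hN.differentiableWithinAt)).hasDerivWithinAt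
  have hAX := hA1.clm_apply hX1
  have hBX := hB1.clm_apply hX1
  have hNAX := hN.clm_apply hAX
  -- Here `X' = -N X` because `e` is parallel, and `B = ∇A`. The first component is `(A X)' = B X -
  -- N A X`. In the second, the Jacobi equation replaces `B'`, and the term `S(N)` of `Φ` cancels
  -- the derivative of `N` along the curve.
  refine (hAX.prodMk (hBX.sub hNAX)).congr_deriv ?_
  have hBt : B t = derivWithin A s t + nonlinConn S p (z t) ∘L A t
    - A t ∘L nonlinConn S p (z t) := rfl
  have hjac : derivWithin B s t + nonlinConn S p (z t) ∘L B t - B t ∘L nonlinConn S p (z t)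
      + jacobiEndo S p (z t) ∘L A t = 0 := hJ.jacobi p t ht
  rw [fderiv_sprayField hS hzd]
  refine Prod.ext ?_ ?_
  · simp only [hBt, add_apply, sub_apply,
      ContinuousLinearMap.comp_apply, map_neg]
    abel
  · have hj := congrArg (fun L : Rn n →L[ℝ] Rn n => L (X t)) hjac
    have hAX' : derivWithin A s t (X t) + A t (-(nonlinConn S p (z t) (X t))) =
        B t (X t) - nonlinConn S p (z t) (A t (X t)) := by
      simp only [hBt, add_apply, sub_apply,
        ContinuousLinearMap.comp_apply, map_neg]
      abel
    simp only [hAX']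
    simp only [jacobiEndo, add_apply, sub_apply,
      ContinuousLinearMap.comp_apply, smul_apply,
      zero_apply] at hj
    have hd : derivWithin B s t (X t) = B t (nonlinConn S p (z t) (X t)) -
        nonlinConn S p (z t) (B t (X t)) -
        ((2 : ℝ) • fderiv ℝ (fun x : Rn n => sprayCoeff S p (x, (z t).2)) (z t).1 (A t (X t)) -
          fderiv ℝ (nonlinConn S p) (z t) ((z t).2, (-2 : ℝ) • sprayCoeff S p (z t)) (A t (X t)) -
          nonlinConn S p (z t) (nonlinConn S p (z t) (A t (X t)))) := by
      rw [← sub_eq_zero, ← hj]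
      abel
    simp only [hd, map_neg, map_sub, sprayField]
    module

end SprayGeometry

namespace SprayGeometry

variable {n : ℕ} {M : Type*} [TopologicalSpace M] [ChartedSpace (EuclideanSpace ℝ (Fin n)) M]

/-! ### Propagation along a curve -/

theorem exists_Icc_mem_nhdsWithin {a b x : ℝ} (hx : x ∈ Icc a b) {T : Set ℝ}
    (hT : T ∈ 𝓝[Icc a b] x) :
    ∃ α β, Icc α β ⊆ T ∩ Icc a b ∧ Icc α β ∈ 𝓝[Icc a b] x ∧ x ∈ Icc α β := by
  obtain ⟨η, hη, h⟩ := Metric.mem_nhdsWithin_iff.1 hT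
  have hsub : Icc (max a (x - η / 2)) (min b (x + η / 2)) ⊆ Icc a b :=
    Icc_subset_Icc (le_max_left _ _) (min_le_left _ _)
  refine ⟨max a (x - η / 2), min b (x + η / 2), fun y hy => ⟨h ⟨?_, hsub hy⟩, hsub hy⟩, ?_, ?_⟩
  · rw [Metric.mem_ball, Real.dist_eq, abs_lt]
    have h1 := (le_max_right _ _).trans hy.1
    have h2 := hy.2.trans (min_le_right _ _)
    constructor <;> linarith
  · filter_upwards [self_mem_nhdsWithin, mem_nhdsWithin_of_mem_nhds
      (Icc_mem_nhds (show x - η / 2 < x by linarith) (show x < x + η / 2 by linarith))] with y h1 h2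
    exact ⟨max_le h1.1 h2.1, le_min h1.2 h2.2⟩
  · exact ⟨max_le hx.1 (by linarith), le_min hx.2 (by linarith)⟩

/-- Solutions of linear equations in charts along a curve that vanish at one time vanish
identically. -/
theorem linear_propagation {X : Type*} [NormedAddCommGroup X] [NormedSpace ℝ X] {c : ℝ → M}
    {a b : ℝ} (hc : ContinuousOn c (Icc a b)) {W : M → ℝ → X} {L : M → ℝ → X →L[ℝ] X}
    (hL : ∀ p, ContinuousOn (L p) (chartTimes (n := n) c (Icc a b) p))
    (hW : ∀ p, ∀ t ∈ chartTimes (n := n) c (Icc a b) p,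
      HasDerivWithinAt (W p) (L p t (W p t)) (Icc a b) t)
    (hch : ∀ p q, ∀ t ∈ chartTimes (n := n) c (Icc a b) p,
      t ∈ chartTimes (n := n) c (Icc a b) q → (∀ᶠ y in 𝓝[Icc a b] t, W p y = 0) → W q t = 0)
    {t₀ : ℝ} {p₀ : M} (ht₀ : t₀ ∈ chartTimes (n := n) c (Icc a b) p₀) (h : W p₀ t₀ = 0) :
    ∀ t, ∀ p, t ∈ chartTimes (n := n) c (Icc a b) p → W p t = 0 := by
  have hloc : ∀ p α β, Icc α β ⊆ chartTimes (n := n) c (Icc a b) p → ∀ y ∈ Icc α β,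
      W p y = 0 → ∀ w ∈ Icc α β, W p w = 0 := by
    intro p α β hsub y hy hWy
    exact eqOn_zero_of_linear_ode ((hL p).mono hsub)
      (fun t ht => (hW p t (hsub ht)).mono fun r hr => (hsub hr).1) hy hWy
  -- A zero at `t` in the chart at `p` first spreads to a neighbourhood of `t` by the linear
  -- equation; only then can `hch` move it to the chart at `q`.
  have hind : ∀ p q, ∀ t ∈ chartTimes (n := n) c (Icc a b) p,
      t ∈ chartTimes (n := n) c (Icc a b) q → W p t = 0 → W q t = 0 := by
    intro p q t hp hq hWt
    obtain ⟨α, β, h1, h2, h3⟩ :=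
      exists_Icc_mem_nhdsWithin hp.1 (chartTimes_mem_nhdsWithin hc hp)
    exact hch p q t hp hq (Filter.mem_of_superset h2
      (hloc p α β (h1.trans inter_subset_left) t h3 hWt))
  let Q : ℝ → Prop := fun t => ∀ p, t ∈ chartTimes (n := n) c (Icc a b) p → W p t = 0
  have key : ∀ x ∈ Icc a b, ∀ᶠ y in 𝓝[Icc a b] x, (Q x → Q y) ∧ (Q y → Q x) := by
    intro x hx
    have hxp : x ∈ chartTimes (n := n) c (Icc a b) (c x) := ⟨hx, mem_chart_source _ _⟩
    obtain ⟨α, β, h1, h2, h3⟩ :=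
      exists_Icc_mem_nhdsWithin hx (chartTimes_mem_nhdsWithin hc hxp)
    have h1' := h1.trans inter_subset_left
    filter_upwards [h2] with y hy
    exact ⟨fun hQ p hp => hind (c x) p y (h1' hy) hp (hloc (c x) α β h1' x h3 (hQ _ hxp) y hy),
      fun hQ p hp => hind (c x) p x hxp hp (hloc (c x) α β h1' y hy (hQ _ (h1' hy)) x h3)⟩
  intro t p ht
  exact isPreconnected_Icc.induction₂' (fun x y => Q x → Q y) key
    (fun _ _ _ _ _ _ h₁ h₂ h => h₂ (h₁ h)) ht₀.1 ht.1 (fun p hp => hind p₀ p t₀ ht₀ hp h) p ht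

variable [IsManifold (𝓡 n) ∞ M]
  {S : (v : TangentBundle (𝓡 n) M) → TangentSpace (𝓡 n).tangent v}

theorem vecComp_eq_zero_iff {c : ℝ → M} {p : M} {X : (t : ℝ) → TangentSpace (𝓡 n) (c t)} {t : ℝ}
    (hp : c t ∈ (chartAt (Rn n) p).source) : vecComp c p X t = 0 ↔ X t = 0 := by
  refine ⟨fun h => ?_, fun h => ?_⟩
  · have h1 := tangentCoordChange_tangentCoordChange (mem_chart_source (Rn n) (c t)) hp (X t)
    rw [vecComp] at h
    rw [h, map_zero] at h1
    exact h1.symm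
  · rw [vecComp, h]
    exact map_zero (tangentCoordChange (𝓡 n) (c t) p (c t))

/-- Parallel fields that are linearly independent at one time are so at all times. -/
theorem linearIndependent_of_isParallel (hS : IsSpray S) {c : ℝ → M} {a b : ℝ}
    (hc : ContinuousOn c (Icc a b))
    (hz : ∀ p, ContinuousOn (tangentCoord (n := n) c (Icc a b) p) (chartTimes (n := n) c (Icc a b) p))
    (hzd : ∀ p, ∀ t ∈ chartTimes (n := n) c (Icc a b) p,
      tangentCoord (n := n) c (Icc a b) p t ∈ coordDomain n p)
    {ι : Type*} [Fintype ι] {e : ι → (t : ℝ) → TangentSpace (𝓡 n) (c t)}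
    (he : ∀ i, IsParallel S c (Icc a b) (e i)) {t₀ : ℝ} (ht₀ : t₀ ∈ Icc a b)
    (hli : LinearIndependent ℝ (fun i => e i t₀)) {t : ℝ} (ht : t ∈ Icc a b) :
    LinearIndependent ℝ (fun i => e i t) := by
  rw [Fintype.linearIndependent_iff] at hli ⊢
  intro g hg
  refine hli g ?_
  -- A combination with constant coefficients is again parallel, so if it vanishes at `t` it
  -- vanishes at `t₀`.
  let X : (t : ℝ) → TangentSpace (𝓡 n) (c t) := fun t => ∑ i, g i • e i t
  have hX : ∀ p t, vecComp c p X t = ∑ i, g i • vecComp c p (e i) t := by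
    intro p t
    have h := map_sum (tangentCoordChange (𝓡 n) (c t) p (c t)) (fun i => g i • (e i t : Rn n))
      Finset.univ
    refine Eq.trans h (Finset.sum_congr rfl fun i _ => ?_)
    exact map_smul (tangentCoordChange (𝓡 n) (c t) p (c t)) (g i) (e i t : Rn n)
  have hsrc : ∀ t ∈ Icc a b, t ∈ chartTimes (n := n) c (Icc a b) (c t) := fun t ht =>
    ⟨ht, mem_chart_source _ _⟩
  have key := linear_propagation hc (W := fun p => vecComp c p X)
    (L := fun p t => -nonlinConn S p (tangentCoord c (Icc a b) p t))
    (fun p t ht => ((differentiableAt_nonlinConn hS (hzd p t ht)).continuousAt.comp_continuousWithinAt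
      (hz p t ht)).neg) (fun p t ht => by
        have h1 : HasDerivWithinAt (fun t => ∑ i, g i • vecComp c p (e i) t)
            (∑ i, g i • (-(nonlinConn S p (tangentCoord c (Icc a b) p t) (vecComp c p (e i) t))))
            (Icc a b) t :=
          HasDerivWithinAt.fun_sum fun i _ =>
            (hasDerivWithinAt_vecComp hc ht (he i)).fun_const_smul (g i)
        refine (h1.congr (fun r _ => hX p r) (hX p t)).congr_deriv ?_
        simp only [hX]
        simp [map_sum, map_smul])
    (fun p q t hp hq h => by
      have := (vecComp_eq_zero_iff hp.2).1 (h.self_of_nhdsWithin hp.1)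
      exact (vecComp_eq_zero_iff hq.2).2 this)
    (hsrc t ht) ((vecComp_eq_zero_iff (hsrc t ht).2).2 hg) t₀ _ (hsrc t₀ ht₀)
  exact (vecComp_eq_zero_iff (hsrc t₀ ht₀).2).1 key

end SprayGeometry

namespace SprayGeometry

variable {n : ℕ} {M : Type*} [TopologicalSpace M] [ChartedSpace (EuclideanSpace ℝ (Fin n)) M]
  [IsManifold (𝓡 n) ∞ M]
  {S : (v : TangentBundle (𝓡 n) M) → TangentSpace (𝓡 n).tangent v}

/-! ### The tangent curve of a geodesic in local coordinates -/

/-- `σ` is an integral curve of the spray `S` which over the set `s` is the tangent curve of `c`. -/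
structure IsTangentLift (S : (v : TangentBundle (𝓡 n) M) → TangentSpace (𝓡 n).tangent v)
    (c : ℝ → M) (s : Set ℝ) (σ : ℝ → TangentBundle (𝓡 n) M) : Prop where
  mem : ∀ t ∈ s, σ t ∈ slashed
  hasMFDerivAt : ∀ t ∈ s, HasMFDerivAt 𝓘(ℝ, ℝ) (𝓡 n).tangent σ t
    ((1 : ℝ →L[ℝ] ℝ).smulRight (S (σ t)))
  eq : ∀ t ∈ s, tangentWithin c s t = σ t

namespace IsTangentLift

variable {c : ℝ → M} {s : Set ℝ} {σ : ℝ → TangentBundle (𝓡 n) M}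

theorem proj_eq (h : IsTangentLift S c s σ) {t : ℝ} (ht : t ∈ s) : (σ t).1 = c t := by
  rw [← h.eq t ht]
  rfl

theorem continuousOn (h : IsTangentLift S c s σ) : ContinuousOn c s := by
  have hπ : Continuous (fun v : TangentBundle (𝓡 n) M => v.1) :=
    FiberBundle.continuous_proj (Rn n) (TangentSpace (𝓡 n))
  intro t ht
  exact (hπ.continuousAt.comp_continuousWithinAt
    (h.hasMFDerivAt t ht).continuousAt.continuousWithinAt).congr
    (fun r hr => (h.proj_eq hr).symm) (h.proj_eq ht).symm

theorem hasDerivWithinAt (hS : IsSpray S) (h : IsTangentLift S c s σ) {p : M} {t : ℝ}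
    (ht : t ∈ chartTimes (n := n) c s p) :
    HasDerivWithinAt (tangentCoord c s p) (sprayField S p (tangentCoord c s p t)) s t := by
  have hp : (σ t).1 ∈ (chartAt (Rn n) p).source := by rw [h.proj_eq ht.1]; exact ht.2
  have h1 := (hasDerivAt_tangentChart hS hp (h.mem t ht.1) (h.hasMFDerivAt t ht.1)).hasDerivWithinAt
    (s := s)
  have h2 : ∀ r ∈ s, tangentCoord (n := n) c s p r = tangentChart p (σ r) := fun r hr => by
    rw [tangentCoord, h.eq r hr]
  rw [h2 t ht.1]
  exact h1.congr h2 (h2 t ht.1)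

theorem mem_coordDomain (h : IsTangentLift S c s σ) {p : M} {t : ℝ}
    (ht : t ∈ chartTimes (n := n) c s p) : tangentCoord c s p t ∈ coordDomain n p := by
  rw [tangentCoord, h.eq t ht.1]
  exact tangentChart_mem_coordDomain (by rw [h.proj_eq ht.1]; exact ht.2) (h.mem t ht.1)

end IsTangentLift

/-- The `∂/∂y`-components of the lift to `TTM` of the vector field `J ∘ e` along `c`. -/
noncomputable def jacobiVelocity (S : (v : TangentBundle (𝓡 n) M) → TangentSpace (𝓡 n).tangent v)
    (c : ℝ → M) (s : Set ℝ)
    (J : (t : ℝ) → TangentSpace (𝓡 n) (c t) →L[ℝ] TangentSpace (𝓡 n) (c t))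
    (e : (t : ℝ) → TangentSpace (𝓡 n) (c t)) (p : M) (t : ℝ) : Rn n :=
  covDerivEndo S c s p (endoComp c p J) t (vecComp c p e t) -
    nonlinConn S p (tangentCoord c s p t) (endoComp c p J t (vecComp c p e t))

variable {P : Type*} [NormedAddCommGroup P] [NormedSpace ℝ P]

/-- If the variation of a family of integral curves of the spray agrees with the Jacobi field
`J ∘ e` to first order at one time, then it agrees with it at all times. -/
theorem variation_eq (hS : IsSpray S) {c : ℝ → M} {a b α β : ℝ} (hab : a < b) (hα : α < a)
    (hβ : b < β) {D : Set P} (hD : IsOpen D) (h0 : 0 ∈ D) {A : P → TangentBundle (𝓡 n) M}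
    {Ψ : ℝ × P → TangentBundle (𝓡 n) M}
    (hΨ : SmoothFlow.IsIntegralFamily (𝓡 n).tangent S slashed A a α β D Ψ)
    (hlift : IsTangentLift S c (Icc a b) fun t => Ψ (t, 0))
    {J : (t : ℝ) → TangentSpace (𝓡 n) (c t) →L[ℝ] TangentSpace (𝓡 n) (c t)}
    (hJ : IsJacobiTensor S c (Icc a b) J) {e : (t : ℝ) → TangentSpace (𝓡 n) (c t)}
    (he : IsParallel S c (Icc a b) e) (w : P) {t₀ : ℝ} {p₀ : M}
    (ht₀ : t₀ ∈ chartTimes (n := n) c (Icc a b) p₀)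
    (hinit : fderiv ℝ (fun q => tangentChart p₀ (Ψ q)) (t₀, 0) (0, w) =
      (endoComp c p₀ J t₀ (vecComp c p₀ e t₀), jacobiVelocity S c (Icc a b) J e p₀ t₀))
    {t : ℝ} {p : M} (ht : t ∈ chartTimes (n := n) c (Icc a b) p) :
    fderiv ℝ (fun q => tangentChart p (Ψ q)) (t, 0) (0, w) =
      (endoComp c p J t (vecComp c p e t), jacobiVelocity S c (Icc a b) J e p t) := by
  have hIcc : ∀ {t : ℝ}, t ∈ Icc a b → t ∈ Ioo α β := fun ht =>
    ⟨hα.trans_le ht.1, ht.2.trans_lt hβ⟩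
  let Ω : M → Set (ℝ × P) := fun p => (Ioo α β ×ˢ D) ∩ Ψ ⁻¹' (tangentChart (n := n) p).source
  have hΩo : ∀ p, IsOpen (Ω p) := fun p =>
    hΨ.contMDiffOn.continuousOn.isOpen_inter_preimage (isOpen_Ioo.prod hD)
      (isOpen_extChartAt_source _)
  have hΩt : ∀ {p t}, t ∈ chartTimes (n := n) c (Icc a b) p → (t, 0) ∈ Ω p := fun {p t} ht =>
    ⟨⟨hIcc ht.1, h0⟩, mem_tangentChart_source.2 (by
      rw [show (Ψ (t, 0)).1 = c t from hlift.proj_eq ht.1]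
      exact ht.2)⟩
  have hsm : ∀ p, ContDiffOn ℝ ∞ (fun q => tangentChart p (Ψ q)) (Ω p) := fun p => by
    refine contMDiffOn_iff_contDiffOn.1 ((contMDiffOn_extChartAt (I := (𝓡 n).tangent)
      (n := ∞) (x := (⟨p, 0⟩ : TangentBundle (𝓡 n) M))).comp
      (hΨ.contMDiffOn.mono inter_subset_left) fun q hq => ?_)
    have := hq.2
    rw [mem_preimage, tangentChart, extChartAt_source] at this
    exact this
  have hode : ∀ p, ∀ q ∈ Ω p, HasDerivAt (fun t => tangentChart p (Ψ (t, q.2)))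
      (sprayField S p (tangentChart p (Ψ q))) q.1 := fun p q hq =>
    hasDerivAt_tangentChart hS (σ := fun t => Ψ (t, q.2)) (mem_tangentChart_source.1 hq.2)
      (hΨ.mem q.2 hq.1.2 q.1 hq.1.1) (hΨ.hasMFDerivAt q.2 hq.1.2 q.1 hq.1.1)
  have hF : ∀ {p t}, t ∈ chartTimes (n := n) c (Icc a b) p →
      ContDiffAt ℝ ∞ (sprayField S p) (tangentCoord c (Icc a b) p t) := fun {p t} ht =>
    (contDiffOn_sprayField hS p).contDiffAt
      ((isOpen_coordDomain p).mem_nhds (hlift.mem_coordDomain ht))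
  have hzeq : ∀ p, ∀ t ∈ Icc a b,
      tangentChart p (Ψ (t, 0)) = tangentCoord (n := n) c (Icc a b) p t := fun p t ht => by
    rw [tangentCoord, hlift.eq t ht]
  -- `Z` is the variation of the family and `Y` the lifted Jacobi field; in every chart both solve
  -- the linearised spray equation along `c`.
  let Z : M → ℝ → Rn n × Rn n := fun p t =>
    fderiv ℝ (fun q => tangentChart p (Ψ q)) (t, 0) (0, w)
  let Y : M → ℝ → Rn n × Rn n := fun p t =>
    (endoComp c p J t (vecComp c p e t), jacobiVelocity S c (Icc a b) J e p t)
  have hZ : ∀ p, ∀ t ∈ chartTimes (n := n) c (Icc a b) p, HasDerivWithinAt (Z p)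
      (fderiv ℝ (sprayField S p) (tangentCoord c (Icc a b) p t) (Z p t)) (Icc a b) t := by
    intro p t ht
    have h1 := hasDerivAt_fderiv_family (F := sprayField S p) (hΩo p) (hsm p) (hode p) (hΩt ht)
      (by rw [hzeq p t ht.1]; exact (hF ht).differentiableAt (by simp)) w
    rw [hzeq p t ht.1] at h1
    exact h1.hasDerivWithinAt
  have hY : ∀ p, ∀ t ∈ chartTimes (n := n) c (Icc a b) p, HasDerivWithinAt (Y p)
      (fderiv ℝ (sprayField S p) (tangentCoord c (Icc a b) p t) (Y p t)) (Icc a b) t :=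
    fun p t ht => hasDerivWithinAt_jacobi hS (uniqueDiffOn_Icc hab) hlift.continuousOn ht
      (hlift.hasDerivWithinAt hS ht) (hlift.mem_coordDomain ht) hJ he
  have hZ1 : ∀ p, ∀ t ∈ chartTimes (n := n) c (Icc a b) p, (Z p t).1 =
      fderiv ℝ (fun q => extChartAt (𝓡 n) p (Ψ q).1) (t, 0) (0, w) := by
    intro p t ht
    have h1 := (((hsm p).contDiffAt ((hΩo p).mem_nhds (hΩt ht))).differentiableAt
      (by simp)).hasFDerivAt.fst
    exact (congrArg (fun L : ℝ × P →L[ℝ] Rn n => L (0, w)) h1.fderiv).symm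
  -- Only first components are compared between charts: they transform as tangent vectors, whereas
  -- the second ones would involve second derivatives of the transition maps.
  have hZch : ∀ p q, ∀ t ∈ chartTimes (n := n) c (Icc a b) p,
      t ∈ chartTimes (n := n) c (Icc a b) q →
      (Z q t).1 = tangentCoordChange (𝓡 n) p q (c t) (Z p t).1 := by
    intro p q t hp hq
    have h1 : HasFDerivAt (fun r => extChartAt (𝓡 n) p (Ψ r).1)
        (fderiv ℝ (fun r => extChartAt (𝓡 n) p (Ψ r).1) (t, 0)) (t, 0) :=
      (((hsm p).contDiffAt ((hΩo p).mem_nhds (hΩt hp))).differentiableAt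
        (by simp)).fst.hasFDerivAt
    have hct : (Ψ (t, 0)).1 = c t := hlift.proj_eq hp.1
    have h2 := hasFDerivWithinAt_tangentCoordChange (I := 𝓡 n) (x := p) (y := q) (z := c t)
      ⟨by rw [extChartAt_source]; exact hp.2, by rw [extChartAt_source]; exact hq.2⟩
    rw [ModelWithCorners.range_eq_univ, hasFDerivWithinAt_univ, ← hct] at h2
    have h3 := h2.comp (t, (0 : P)) h1
    have h4 : (fun r => extChartAt (𝓡 n) q (Ψ r).1) =ᶠ[𝓝 (t, 0)]
        (extChartAt (𝓡 n) q ∘ (extChartAt (𝓡 n) p).symm) ∘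
          fun r => extChartAt (𝓡 n) p (Ψ r).1 := by
      filter_upwards [(hΩo p).mem_nhds (hΩt hp)] with r hr
      have : (Ψ r).1 ∈ (extChartAt (𝓡 n) p).source := by
        rw [extChartAt_source]; exact mem_tangentChart_source.1 hr.2
      simp only [Function.comp_apply, (extChartAt (𝓡 n) p).left_inv this]
    rw [hZ1 p t hp, hZ1 q t hq, (h3.congr_of_eventuallyEq h4).fderiv, hct]
    rfl
  have hYch : ∀ p q, ∀ t ∈ chartTimes (n := n) c (Icc a b) p,
      t ∈ chartTimes (n := n) c (Icc a b) q →
      (Y q t).1 = tangentCoordChange (𝓡 n) p q (c t) (Y p t).1 := by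
    intro p q t hp hq
    change endoComp c q J t (vecComp c q e t) =
      tangentCoordChange (𝓡 n) p q (c t) (endoComp c p J t (vecComp c p e t))
    rw [endoComp_vecComp hq.2, endoComp_vecComp hp.2, vecComp_change hp.2 hq.2]
  have key := linear_propagation hlift.continuousOn (W := fun p t => Z p t - Y p t)
    (L := fun p t => fderiv ℝ (sprayField S p) (tangentCoord c (Icc a b) p t))
    (fun p t ht => by
      have h1 : ContinuousAt (fderiv ℝ (sprayField S p)) (tangentCoord c (Icc a b) p t) :=
        ((hF ht).fderiv_right (m := 0) (by simp)).continuousAt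
      exact h1.comp_continuousWithinAt
        ((hlift.hasDerivWithinAt hS ht).continuousWithinAt.mono fun r hr => hr.1))
    (fun p t ht => by
      rw [map_sub]
      exact (hZ p t ht).sub (hY p t ht))
    -- The first component of the difference vanishes near `t` in the chart at `q`. Its derivative
    -- is the second component, which therefore vanishes at `t` too.
    (fun p q t hp hq h => by
      have h1 : ∀ᶠ y in 𝓝[Icc a b] t, (Z q y - Y q y).1 = 0 := by
        filter_upwards [h, chartTimes_mem_nhdsWithin hlift.continuousOn hp,
          chartTimes_mem_nhdsWithin hlift.continuousOn hq] with y hy hyp hyq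
        rw [Prod.fst_sub, hZch p q y hyp hyq, hYch p q y hyp hyq, ← map_sub, ← Prod.fst_sub, hy]
        exact map_zero _
      have h2 : HasDerivWithinAt (fun y => (Z q y - Y q y).1) _ (Icc a b) t :=
        (ContinuousLinearMap.fst ℝ (Rn n) (Rn n)).hasFDerivAt.comp_hasDerivWithinAt t
          ((hZ q t hq).sub (hY q t hq))
      have h3 := h2.congr_of_eventuallyEq (f₁ := fun _ => 0)
        (h1.mono fun y hy => hy.symm) (h1.self_of_nhdsWithin hq.1).symm
      have h4 := (uniqueDiffOn_Icc hab t hq.1).eq_deriv _ h3 (hasDerivWithinAt_const t _ 0)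
      rw [ContinuousLinearMap.coe_fst', fderiv_sprayField hS (hlift.mem_coordDomain hq),
        fderiv_sprayField hS (hlift.mem_coordDomain hq)] at h4
      exact Prod.ext (h1.self_of_nhdsWithin hq.1) h4)
    ht₀ (sub_eq_zero.2 hinit) t p ht
  exact sub_eq_zero.1 key

end SprayGeometry

namespace SprayGeometry

variable {n : ℕ} {M : Type*} [TopologicalSpace M] [ChartedSpace (EuclideanSpace ℝ (Fin n)) M]
  [IsManifold (𝓡 n) ∞ M]

/-! ### Local diffeomorphisms -/

/-- In equal finite dimensions an injective differential is invertible, so the inverse function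
theorem applies in a chart. -/
theorem isLocalDiffeomorphAt_of_injective {X : Type*} [NormedAddCommGroup X] [NormedSpace ℝ X]
    [FiniteDimensional ℝ X] (hdim : Module.finrank ℝ X = n) {V : X → M} {Ω : Set X}
    (hΩ : IsOpen Ω) (hV : ContMDiffOn 𝓘(ℝ, X) (𝓡 n) ∞ V Ω) {z₀ : X} (hz₀ : z₀ ∈ Ω) {p : M}
    (hp : V z₀ ∈ (chartAt (Rn n) p).source)
    (hinj : ∀ w, fderiv ℝ (fun z => extChartAt (𝓡 n) p (V z)) z₀ w = 0 → w = 0) :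
    IsLocalDiffeomorphAt 𝓘(ℝ, X) (𝓡 n) ∞ V z₀ := by
  have : CompleteSpace X := FiniteDimensional.complete ℝ X
  set φ := extChartAt (𝓡 n) p with hφ
  have hΩ' : IsOpen (Ω ∩ V ⁻¹' φ.source) :=
    hV.continuousOn.isOpen_inter_preimage hΩ (isOpen_extChartAt_source p)
  have hz₀' : z₀ ∈ Ω ∩ V ⁻¹' φ.source := ⟨hz₀, by rwa [mem_preimage, hφ, extChartAt_source]⟩
  have hf : ContDiffOn ℝ ∞ (fun z => φ (V z)) (Ω ∩ V ⁻¹' φ.source) :=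
    contMDiffOn_iff_contDiffOn.1 ((contMDiffOn_extChartAt (I := 𝓡 n) (n := ∞) (x := p)).comp
      (hV.mono inter_subset_left) fun z hz => by
        have := hz.2
        rwa [mem_preimage, hφ, extChartAt_source] at this)
  have hd := ((hf.contDiffAt (hΩ'.mem_nhds hz₀')).differentiableAt (by simp)).hasFDerivAt
  let L : X ≃L[ℝ] Rn n := (LinearEquiv.ofInjectiveOfFinrankEq
    (fderiv ℝ (fun z => φ (V z)) z₀).toLinearMap
    ((injective_iff_map_eq_zero _).2 hinj) (by rw [hdim]; simp)).toContinuousLinearEquiv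
  obtain ⟨e, h1, h2, h3, h4⟩ := exists_openPartialHomeomorph_contDiffOn_symm hΩ' hf hz₀' L
    (hd.congr_fderiv (by ext; rfl))
  have hmaps : ∀ z ∈ e.source, e z ∈ φ.target := fun z hz => by
    rw [h3]; exact φ.map_source (h2 hz).2
  -- The local inverse in the chart is composed with the inverse chart; `hmaps` shows that this does
  -- not cut down its source.
  let Φ : PartialDiffeomorph 𝓘(ℝ, X) (𝓡 n) X M ∞ :=
    { toPartialEquiv := e.toPartialEquiv.trans φ.symm
      open_source := by
        have : (e.toPartialEquiv.trans φ.symm).source = e.source := by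
          rw [PartialEquiv.trans_source]
          exact inter_eq_left.2 hmaps
        rw [this]
        exact e.open_source
      open_target := by
        rw [PartialEquiv.trans_target]
        exact (continuousOn_extChartAt p).isOpen_inter_preimage (isOpen_extChartAt_source p)
          e.open_target
      contMDiffOn_toFun := by
        refine (contMDiffOn_extChartAt_symm (I := 𝓡 n) (n := ∞) p).comp
          (contMDiffOn_iff_contDiffOn.2 ?_) fun z hz => hz.2
        have : ContDiffOn ℝ ∞ e e.source := by rw [h3]; exact hf.mono h2
        exact this.mono fun z hz => hz.1
      contMDiffOn_invFun := by
        rw [PartialEquiv.trans_target]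
        refine (contMDiffOn_iff_contDiffOn.2 h4).comp
          ((contMDiffOn_extChartAt (I := 𝓡 n) (n := ∞) (x := p)).mono fun y hy => ?_)
          fun y hy => hy.2
        have := hy.1
        rwa [PartialEquiv.symm_target, hφ, extChartAt_source] at this }
  refine ⟨Φ, ⟨h1, hmaps z₀ h1⟩, fun z hz => ?_⟩
  change V z = φ.symm (e z)
  rw [h3, φ.left_inv (h2 hz.1).2]

omit [IsManifold (𝓡 n) ∞ M] in
theorem isOpen_setOf_isLocalDiffeomorphAt {X : Type*} [NormedAddCommGroup X] [NormedSpace ℝ X]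
    (V : X → M) : IsOpen {z | IsLocalDiffeomorphAt 𝓘(ℝ, X) (𝓡 n) ∞ V z} := by
  rw [isOpen_iff_mem_nhds]
  rintro z ⟨Φ, hz, heq⟩
  exact Filter.mem_of_superset (Φ.open_source.mem_nhds hz) fun w hw => ⟨Φ, hw, heq⟩

-- Injectivity makes the global inverse coincide locally with the inverses of the local
-- diffeomorphisms, hence smooth.
omit [IsManifold (𝓡 n) ∞ M] in
theorem isDiffeoOntoRange_of_injOn {V : ℝ × (Fin (n - 1) → ℝ) → M}
    {D : Set (ℝ × (Fin (n - 1) → ℝ))} (hD : IsOpen D) (hinj : InjOn V D)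
    (hV : ∀ z ∈ D, IsLocalDiffeomorphAt 𝓘(ℝ, ℝ × (Fin (n - 1) → ℝ)) (𝓡 n) ∞ V z) :
    IsDiffeoOntoRange V D := by
  have hloc : ∀ z ∈ D, ∃ O : Set M, IsOpen O ∧ V z ∈ O ∧ O ⊆ V '' D ∧
      ContMDiffOn (𝓡 n) 𝓘(ℝ, ℝ × (Fin (n - 1) → ℝ)) ∞ (Function.invFunOn V D) O := by
    intro z hz
    obtain ⟨Φ, hzΦ, heq⟩ := hV z hz
    have himg : V '' (Φ.source ∩ D) = Φ '' (Φ.source ∩ D) :=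
      image_congr fun w hw => heq hw.1
    refine ⟨V '' (Φ.source ∩ D), ?_, mem_image_of_mem V ⟨hzΦ, hz⟩,
      image_mono inter_subset_right, ?_⟩
    · rw [himg]
      exact Φ.toOpenPartialHomeomorph.isOpen_image_of_subset_source (Φ.open_source.inter hD)
        inter_subset_left
    · refine (Φ.contMDiffOn_invFun.mono ?_).congr ?_
      · rintro _ ⟨w, hw, rfl⟩
        rw [heq hw.1]
        exact Φ.map_source hw.1
      · rintro _ ⟨w, hw, rfl⟩
        rw [hinj.leftInvOn_invFunOn hw.2, heq hw.1]
        exact (Φ.left_inv hw.1).symm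
  refine ⟨fun z hz => (hV z hz).contMDiffAt.contMDiffWithinAt, ?_, Function.invFunOn V D,
    hinj.leftInvOn_invFunOn, ?_⟩
  · rw [isOpen_iff_mem_nhds]
    rintro _ ⟨z, hz, rfl⟩
    obtain ⟨O, h1, h2, h3, -⟩ := hloc z hz
    exact Filter.mem_of_superset (h1.mem_nhds h2) h3
  · rintro _ ⟨z, hz, rfl⟩
    obtain ⟨O, h1, h2, -, h4⟩ := hloc z hz
    exact (h4.contMDiffAt (h1.mem_nhds h2)).contMDiffWithinAt

theorem exists_box_subset {O : Set (ℝ × (Fin (n - 1) → ℝ))} (hO : IsOpen O) {a b : ℝ}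
    (hab : a ≤ b) (h : Icc a b ×ˢ {0} ⊆ O) :
    ∃ a' b' ε, a' < a ∧ b < b' ∧ 0 < ε ∧ box n a' b' ε ⊆ O := by
  obtain ⟨u, v, hu, hv, hau, h0v, huv⟩ :=
    generalized_tube_lemma isCompact_Icc isCompact_singleton hO h
  obtain ⟨δ₁, hδ₁, h1⟩ := Metric.isOpen_iff.1 hu a (hau ⟨le_rfl, hab⟩)
  obtain ⟨δ₂, hδ₂, h2⟩ := Metric.isOpen_iff.1 hu b (hau ⟨hab, le_rfl⟩)
  obtain ⟨ε, hε, h3⟩ := Metric.isOpen_iff.1 hv 0 (h0v rfl)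
  -- Balls around the two end points enlarge `[a, b]` inside `u`; in the sup norm the ball of radius
  -- `ε` is the cube.
  refine ⟨a - δ₁, b + δ₂, ε, by linarith, by linarith, hε, fun z hz => huv ⟨?_, h3 ?_⟩⟩
  · have h4 := hz.1
    rcases lt_or_ge z.1 a with ha | ha
    · apply h1
      rw [Metric.mem_ball, Real.dist_eq, abs_lt]
      constructor <;> linarith [h4.1]
    · rcases le_or_gt z.1 b with hb | hb
      · exact hau ⟨ha, hb⟩
      · apply h2
        rw [Metric.mem_ball, Real.dist_eq, abs_lt]
        constructor <;> linarith [h4.2]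
  · rw [mem_ball_zero_iff, pi_norm_lt_iff hε]
    intro i
    exact abs_lt.2 (hz.2 i trivial)

theorem isOpen_box (a b ε : ℝ) : IsOpen (box n a b ε) :=
  isOpen_Ioo.prod (isOpen_set_pi finite_univ fun _ _ => isOpen_Ioo)

/-! ### The variation through geodesics -/

variable {S : (v : TangentBundle (𝓡 n) M) → TangentSpace (𝓡 n).tangent v}

-- One-sided derivatives at the end points equal the derivatives of the extension, so `c'` does not
-- depend on which set the derivative is taken in.
omit [IsManifold (𝓡 n) ∞ M] in
theorem tangentWithin_Icc_eq {c γ : ℝ → M} {a b a' b' : ℝ} (hab : a < b) (ha : a' < a)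
    (hb : b < b') (h : EqOn γ c (Icc a b)) (hγ : ContMDiffOn 𝓘(ℝ, ℝ) (𝓡 n) ∞ γ (Ioo a' b')) {t : ℝ}
    (ht : t ∈ Icc a b) : (tangentWithin c (Icc a b) t : TangentBundle (𝓡 n) M) =
      tangentWithin γ (Ioo a' b') t := by
  have ht' : t ∈ Ioo a' b' := ⟨ha.trans_le ht.1, ht.2.trans_lt hb⟩
  have hd : MDifferentiableAt 𝓘(ℝ, ℝ) (𝓡 n) γ t :=
    (hγ.contMDiffAt (isOpen_Ioo.mem_nhds ht')).mdifferentiableAt (by simp)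
  have hu : UniqueMDiffWithinAt 𝓘(ℝ, ℝ) (Icc a b) t :=
    uniqueMDiffWithinAt_iff_uniqueDiffWithinAt.2 (uniqueDiffOn_Icc hab t ht)
  have h1 : (mfderivWithin 𝓘(ℝ, ℝ) (𝓡 n) c (Icc a b) t (1 : ℝ) : Rn n) =
      mfderivWithin 𝓘(ℝ, ℝ) (𝓡 n) γ (Ioo a' b') t (1 : ℝ) := by
    have h2 : (mfderivWithin 𝓘(ℝ, ℝ) (𝓡 n) c (Icc a b) t : ℝ →L[ℝ] Rn n) =
        mfderivWithin 𝓘(ℝ, ℝ) (𝓡 n) γ (Icc a b) t :=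
      mfderivWithin_congr (fun r hr => (h hr).symm) (h ht).symm
    have h3 : mfderivWithin 𝓘(ℝ, ℝ) (𝓡 n) γ (Icc a b) t = mfderiv 𝓘(ℝ, ℝ) (𝓡 n) γ t :=
      mfderivWithin_eq_mfderiv hu hd
    have h4 : mfderivWithin 𝓘(ℝ, ℝ) (𝓡 n) γ (Ioo a' b') t = mfderiv 𝓘(ℝ, ℝ) (𝓡 n) γ t :=
      mfderivWithin_of_isOpen isOpen_Ioo ht'
    exact congrArg (fun L : ℝ →L[ℝ] Rn n => L 1) (h2.trans (h3.trans h4.symm))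
  have key : ∀ (x y : M) (v w : Rn n), x = y → v = w →
      (⟨x, v⟩ : TangentBundle (𝓡 n) M) = ⟨y, w⟩ := by
    rintro x _ v _ rfl rfl
    rfl
  exact key _ _ _ _ (h ht).symm h1

/-- A family of geodesics around `c` whose variation is prescribed by a Jacobi tensor. -/
theorem exists_geodesic_family [T2Space M] (hS : IsSpray S) {a b : ℝ} (hab : a < b) {c : ℝ → M}
    (hc : IsGeodesicOnIcc S c a b)
    {J : (t : ℝ) → TangentSpace (𝓡 n) (c t) →L[ℝ] TangentSpace (𝓡 n) (c t)}
    (hJ : IsJacobiTensor S c (Icc a b) J) {e : Fin (n - 1) → (t : ℝ) → TangentSpace (𝓡 n) (c t)}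
    (he : ∀ i, IsParallel S c (Icc a b) (e i)) :
    ∃ (α β : ℝ) (D : Set (Fin (n - 1) → ℝ)) (A : (Fin (n - 1) → ℝ) → TangentBundle (𝓡 n) M)
      (Ψ : ℝ × (Fin (n - 1) → ℝ) → TangentBundle (𝓡 n) M), α < a ∧ b < β ∧ IsOpen D ∧ 0 ∈ D ∧
      SmoothFlow.IsIntegralFamily (𝓡 n).tangent S slashed A a α β D Ψ ∧
      IsTangentLift S c (Icc a b) (fun t => Ψ (t, 0)) ∧
      ∀ i p, ∀ t ∈ chartTimes (n := n) c (Icc a b) p,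
        fderiv ℝ (fun q => tangentChart p (Ψ q)) (t, 0) (0, Pi.single i 1) =
          (endoComp c p J t (vecComp c p (e i) t),
            jacobiVelocity S c (Icc a b) J (e i) p t) := by
  have := t2Space_tangentBundle (n := n) (M := M)
  obtain ⟨a', b', γ, ha', hb', hγc, hγ⟩ := hc
  let σ : ℝ → TangentBundle (𝓡 n) M := tangentWithin γ (Ioo a' b')
  have hat : a ∈ chartTimes (n := n) c (Icc a b) (c a) :=
    ⟨⟨le_rfl, hab.le⟩, mem_chart_source _ _⟩
  have hσa : (σ a).1 ∈ (chartAt (Rn n) (c a)).source := by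
    rw [show (σ a).1 = c a from hγc hat.1]
    exact hat.2
  let z₀ : Rn n × Rn n := tangentChart (c a) (σ a)
  let ζ : Fin (n - 1) → Rn n × Rn n := fun i =>
    (endoComp c (c a) J a (vecComp c (c a) (e i) a),
      jacobiVelocity S c (Icc a b) J (e i) (c a) a)
  let ℓ : (Fin (n - 1) → ℝ) →L[ℝ] Rn n × Rn n :=
    ∑ i, (ContinuousLinearMap.proj i : (Fin (n - 1) → ℝ) →L[ℝ] ℝ).smulRight (ζ i)
  have hℓ : ∀ i, ℓ (Pi.single i 1) = ζ i := fun i => by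
    simp [ℓ, Pi.single_apply]
  -- The parameters for which the affine initial datum `z₀ + ℓ s` lies in the image of the chart of
  -- `TM`, so that it represents a vector.
  let D₀ : Set (Fin (n - 1) → ℝ) := (fun s => z₀ + ℓ s) ⁻¹' (tangentChart (n := n) (c a)).target
  have hD₀ : IsOpen D₀ := (isOpen_extChartAt_target _).preimage (by fun_prop)
  have hz₀ : z₀ ∈ (tangentChart (n := n) (c a)).target :=
    (tangentChart (c a)).map_source (mem_tangentChart_source.2 hσa)
  have h0D₀ : (0 : Fin (n - 1) → ℝ) ∈ D₀ := by
    change z₀ + ℓ 0 ∈ (tangentChart (n := n) (c a)).target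
    rw [map_zero, add_zero]
    exact hz₀
  let A : (Fin (n - 1) → ℝ) → TangentBundle (𝓡 n) M := fun s => (tangentChart (c a)).symm (z₀ + ℓ s)
  have hA : ContMDiffOn 𝓘(ℝ, Fin (n - 1) → ℝ) (𝓡 n).tangent ∞ A D₀ :=
    (contMDiffOn_extChartAt_symm (I := (𝓡 n).tangent) (n := ∞)
      (⟨c a, 0⟩ : TangentBundle (𝓡 n) M)).comp
      (contMDiff_iff_contDiff.2 (contDiff_const.add ℓ.contDiff)).contMDiffOn fun s hs => hs
  have hA0 : A 0 = σ a := by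
    change (tangentChart (c a)).symm (z₀ + ℓ 0) = _
    rw [map_zero, add_zero]
    exact (tangentChart (c a)).left_inv (mem_tangentChart_source.2 hσa)
  obtain ⟨α, β, D', Ψ, hα, hβ, hD', h0D', hΨ', hΨ0⟩ :=
    SmoothFlow.exists_isIntegralFamily (isOpen_slashed (n := n) (M := M)) hS.smooth hab.le ha' hb'
      (σ := σ) hγ.regular (fun t ht => hγ.hasMFDerivAt isOpen_Ioo ht) hD₀ h0D₀ hA hA0
  have hΨ := hΨ'.mono (inter_subset_left (s := D') (t := D₀))
  have hIcc : ∀ t ∈ Icc a b, t ∈ Ioo α β := fun t ht => ⟨hα.trans_le ht.1, ht.2.trans_lt hβ⟩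
  have hlift : IsTangentLift S c (Icc a b) (fun t => Ψ (t, 0)) :=
    ⟨fun t ht => hΨ'.mem 0 h0D' t (hIcc t ht), fun t ht => hΨ'.hasMFDerivAt 0 h0D' t (hIcc t ht),
      fun t ht => (tangentWithin_Icc_eq hab ha' hb' hγc hγ.smooth ht).trans (hΨ0 t ht).symm⟩
  refine ⟨α, β, D' ∩ D₀, A, Ψ, hα, hβ, hD'.inter hD₀, ⟨h0D', h0D₀⟩, hΨ, hlift,
    fun i p t ht => ?_⟩
  refine variation_eq hS hab hα hβ (hD'.inter hD₀) ⟨h0D', h0D₀⟩ hΨ hlift hJ (he i) _ hat ?_ ht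
  have hd : HasFDerivAt (fun q => tangentChart (c a) (Ψ q))
      (fderiv ℝ (fun q => tangentChart (c a) (Ψ q)) (a, 0)) (a, 0) := by
    refine DifferentiableAt.hasFDerivAt ?_
    have h1 : ContMDiffAt 𝓘(ℝ, ℝ × (Fin (n - 1) → ℝ)) (𝓡 n).tangent ∞ Ψ (a, 0) :=
      hΨ'.contMDiffOn.contMDiffAt ((isOpen_Ioo.prod hD').mem_nhds ⟨hIcc a hat.1, h0D'⟩)
    have h2 : ContMDiffAt (𝓡 n).tangent 𝓘(ℝ, Rn n × Rn n) ∞ (tangentChart (n := n) (c a))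
        (Ψ (a, 0)) := by
      refine contMDiffAt_extChartAt' ?_
      rw [TangentBundle.mem_chart_source_iff, hΨ0 a hat.1]
      exact hσa
    exact (contMDiffAt_iff_contDiffAt.1 (h2.comp (a, 0) h1)).differentiableAt (by simp)
  -- At the time `a` the family reads `s ↦ z₀ + ℓ s` in this chart, for parameters in `D₀`; its
  -- derivative is `ℓ`, which is the initial condition required by `variation_eq`.
  have h3 := hd.comp (0 : Fin (n - 1) → ℝ) (hasFDerivAt_prodMk_right a (0 : Fin (n - 1) → ℝ))
  have h4 : HasFDerivAt (fun s => z₀ + ℓ s) ℓ (0 : Fin (n - 1) → ℝ) := ℓ.hasFDerivAt.const_add z₀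
  have h5 : ((fun q => tangentChart (c a) (Ψ q)) ∘ fun s => (a, s)) =ᶠ[𝓝 0]
      fun s => z₀ + ℓ s := by
    filter_upwards [(hD'.inter hD₀).mem_nhds ⟨h0D', h0D₀⟩] with s hs
    simp only [Function.comp_apply]
    rw [hΨ.init s hs]
    exact (tangentChart (c a)).right_inv hs.2
  have h6 := (h4.congr_of_eventuallyEq h5).unique h3
  have h7 := congrArg (fun L => L (Pi.single i 1)) h6
  rw [hℓ] at h7
  exact h7.symm

end SprayGeometry

/-! ### Independence of the coordinate frame and the adapted coordinates -/

namespace SprayGeometry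

variable {n : ℕ} {M : Type*} [TopologicalSpace M] [ChartedSpace (EuclideanSpace ℝ (Fin n)) M]
  [IsManifold (𝓡 n) ∞ M]
  {S : (v : TangentBundle (𝓡 n) M) → TangentSpace (𝓡 n).tangent v}

/-- The tangent vector of `c` and the images under an invertible tensor of a basis of the
hyperplanes are linearly independent. -/
theorem eq_zero_of_smul_add_tensor_eq_zero {T ι : Type*} [NormedAddCommGroup T] [NormedSpace ℝ T]
    [Fintype ι] {J : T →L[ℝ] T} {v : T} {e : ι → T} {W : Submodule ℝ T} (hv : v ≠ 0)
    (hJv : J v = 0) (hW : W = Submodule.span ℝ (range e)) (hJW : ∀ w, J w ∈ W)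
    (hbij : BijOn J (W : Set T) W) (he : LinearIndependent ℝ e) {τ : ℝ} {w : ι → ℝ}
    (h : τ • v + J (∑ i, w i • e i) = 0) : τ = 0 ∧ w = 0 := by
  have hu : ∑ i, w i • e i ∈ W := by
    rw [hW]
    exact Submodule.sum_mem _ fun i _ => Submodule.smul_mem _ _ (Submodule.subset_span ⟨i, rfl⟩)
  have hτ : τ = 0 := by
    by_contra hne
    have h1 : v = (-τ⁻¹) • J (∑ i, w i • e i) := by
      rw [eq_neg_of_add_eq_zero_right h, smul_neg, neg_smul, neg_neg, smul_smul,
        inv_mul_cancel₀ hne, one_smul]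
    have hvW : v ∈ W := by
      rw [h1]
      exact Submodule.smul_mem _ _ (hJW _)
    -- If `τ ≠ 0`, then `v` lies in `W` and has the same image under `J` as `0`, against injectivity
    -- on `W`.
    exact hv (hbij.injOn hvW W.zero_mem (by rw [hJv, map_zero]))
  refine ⟨hτ, ?_⟩
  rw [hτ, zero_smul, zero_add] at h
  have h2 : ∑ i, w i • e i = 0 := hbij.injOn hu W.zero_mem (by rw [h, map_zero])
  exact funext (Fintype.linearIndependent_iff.1 he w h2)

end SprayGeometry

open SprayGeometry in
theorem mainTheorem3 (n : ℕ) (hn : 2 ≤ n)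
    {M : Type*} [TopologicalSpace M] [T2Space M] [SecondCountableTopology M]
    [ChartedSpace (EuclideanSpace ℝ (Fin n)) M] [IsManifold (𝓡 n) ∞ M]
    (S : (v : TangentBundle (𝓡 n) M) → TangentSpace (𝓡 n).tangent v)
    (hS : SprayGeometry.IsSpray S)
    (a b : ℝ) (hab : a < b) (c : ℝ → M)
    (hc : SprayGeometry.IsGeodesicOnIcc S c a b) (hinj : Set.InjOn c (Set.Icc a b))
    (J : (t : ℝ) → TangentSpace (𝓡 n) (c t) →L[ℝ] TangentSpace (𝓡 n) (c t))
    (hJ : SprayGeometry.IsJacobiTensor S c (Set.Icc a b) J)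
    (hJinv : SprayGeometry.IsInvertibleTensor S c (Set.Icc a b) J) :
    ∃ (a' b' ε : ℝ) (V : ℝ × (Fin (n - 1) → ℝ) → M),
      a' < a ∧ b < b' ∧ 0 < ε ∧
      (∀ t ∈ Set.Icc a b, V (t, 0) = c t) ∧
      SprayGeometry.IsDiffeoOntoRange V (SprayGeometry.box n a' b' ε) ∧
      ∀ s : Fin (n - 1) → ℝ, (∀ i, s i ∈ Set.Ioo (-ε) ε) →
        SprayGeometry.IsGeodesicOnOpen S (fun t => V (t, s)) (Set.Ioo a' b') := by
  obtain ⟨W, ⟨e, he, hW, t₀, ht₀, hli, -⟩, htrans, hbij⟩ := hJinv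
  obtain ⟨α, β, D, A, Ψ, hα, hβ, hD, h0D, hΨ, hlift, hvar⟩ :=
    exists_geodesic_family hS hab hc hJ he
  have hIcc : ∀ t ∈ Icc a b, t ∈ Ioo α β := fun t ht => ⟨hα.trans_le ht.1, ht.2.trans_lt hβ⟩
  have hΩ : IsOpen (Ioo α β ×ˢ D) := isOpen_Ioo.prod hD
  have hV : ContMDiffOn 𝓘(ℝ, ℝ × (Fin (n - 1) → ℝ)) (𝓡 n) ∞ (fun q => (Ψ q).1) (Ioo α β ×ˢ D) :=
    (Bundle.contMDiff_proj (TangentSpace (𝓡 n) : M → Type)).comp_contMDiffOn hΨ.contMDiffOn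
  have hVc : ∀ t ∈ Icc a b, (Ψ (t, 0)).1 = c t := fun t ht => hlift.proj_eq ht
  have hlocal : ∀ t ∈ Icc a b, IsLocalDiffeomorphAt 𝓘(ℝ, ℝ × (Fin (n - 1) → ℝ)) (𝓡 n) ∞
      (fun q => (Ψ q).1) (t, 0) := by
    intro t ht
    have htc : t ∈ chartTimes (n := n) c (Icc a b) (c t) := ⟨ht, mem_chart_source _ _⟩
    have hsrc : (Ψ (t, 0)).1 ∈ (chartAt (Rn n) (c t)).source := by rw [hVc t ht]; exact htc.2
    refine isLocalDiffeomorphAt_of_injective (p := c t)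
      -- The dimension count is `1 + (n - 1) = n`; the truncated subtraction is harmless because `n`
      -- is positive.
      (by rw [Module.finrank_prod, Module.finrank_self, Module.finrank_fin_fun]; omega)
      hΩ hV ⟨hIcc t ht, h0D⟩ hsrc ?_
    rintro ⟨τ, w⟩ hw
    have hsm : DifferentiableAt ℝ (fun q => tangentChart (c t) (Ψ q)) (t, 0) := by
      have h1 := hΨ.contMDiffOn.contMDiffAt (hΩ.mem_nhds
        (show (t, (0 : Fin (n - 1) → ℝ)) ∈ Ioo α β ×ˢ D from ⟨hIcc t ht, h0D⟩))
      have h2 : ContMDiffAt (𝓡 n).tangent 𝓘(ℝ, Rn n × Rn n) ∞ (tangentChart (n := n) (c t))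
          (Ψ (t, 0)) := contMDiffAt_extChartAt' (by
        rw [TangentBundle.mem_chart_source_iff]; exact hsrc)
      exact (contMDiffAt_iff_contDiffAt.1 (h2.comp (t, 0) h1)).differentiableAt (by simp)
    have hfst : ∀ u, fderiv ℝ (fun q => extChartAt (𝓡 n) (c t) (Ψ q).1) (t, 0) u =
        (fderiv ℝ (fun q => tangentChart (c t) (Ψ q)) (t, 0) u).1 := fun u =>
      congrArg (fun L : ℝ × (Fin (n - 1) → ℝ) →L[ℝ] Rn n => L u) hsm.hasFDerivAt.fst.fderiv
    let κ : Rn n →L[ℝ] Rn n := tangentCoordChange (𝓡 n) (c t) (c t) (c t)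
    -- The chart is taken at `c t` itself, so components there are the tangent vectors without any
    -- coordinate change.
    have hκ : ∀ u, κ u = u := fun u => tangentCoordChange_self (mem_extChartAt_source (c t))
    let v : Rn n := (tangentWithin (n := n) c (Icc a b) t).2
    have htime : (fderiv ℝ (fun q => tangentChart (c t) (Ψ q)) (t, 0) (1, 0)).1 = v := by
      have h1 : HasDerivAt (fun t : ℝ => (t, (0 : Fin (n - 1) → ℝ))) ((1 : ℝ), 0) t :=
        (hasDerivAt_id t).prodMk (hasDerivAt_const t 0)
      have h2 := hsm.hasFDerivAt.comp_hasDerivAt t h1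
      have h3 := hasDerivAt_tangentChart hS (σ := fun t => Ψ (t, 0)) hsrc (hlift.mem t ht)
        (hlift.hasMFDerivAt t ht)
      rw [h2.unique h3, ← hlift.eq t ht]
      exact hκ v
    let Jt : Rn n →L[ℝ] Rn n := J t
    let et : Fin (n - 1) → Rn n := fun i => e i t
    have hspace : ∀ i, (fderiv ℝ (fun q => tangentChart (c t) (Ψ q)) (t, 0)
        (0, Pi.single i 1)).1 = Jt (et i) := by
      intro i
      rw [hvar i (c t) t htc]
      exact (endoComp_vecComp htc.2).trans (hκ _)
    have hdecomp : ((τ, w) : ℝ × (Fin (n - 1) → ℝ)) =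
        τ • ((1 : ℝ), (0 : Fin (n - 1) → ℝ)) + ∑ i, w i • ((0 : ℝ), Pi.single i (1 : ℝ)) := by
      refine Prod.ext ?_ ?_
      · simp [Prod.fst_sum]
      · ext j
        simp [Prod.snd_sum, Finset.sum_apply, Pi.single_apply]
    have hsum : τ • v + Jt (∑ i, w i • et i) = 0 := by
      rw [hfst, hdecomp, map_add, map_smul, map_sum, Prod.fst_add, Prod.smul_fst, htime,
        Prod.fst_sum] at hw
      rw [map_sum, ← hw]
      congr 1
      refine Finset.sum_congr rfl fun i _ => ?_
      rw [map_smul, map_smul, Prod.smul_fst, hspace i]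
    have hvne : v ≠ 0 := by
      have := hlift.mem t ht
      rw [← hlift.eq t ht] at this
      exact this
    have hlit := linearIndependent_of_isParallel hS hlift.continuousOn
      (fun p r hr => (hlift.hasDerivWithinAt hS hr).continuousWithinAt.mono fun q hq => hq.1)
      (fun p r hr => hlift.mem_coordDomain hr) he ht₀ hli ht
    obtain ⟨h1, h2⟩ := eq_zero_of_smul_add_tensor_eq_zero (T := Rn n) (W := W t) hvne
      (htrans t ht).1 (hW t ht) (htrans t ht).2 (hbij t ht) hlit hsum
    rw [h1, h2]
    rfl
  have hinjK : InjOn (fun q => (Ψ q).1) (Icc a b ×ˢ {(0 : Fin (n - 1) → ℝ)}) := by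
    rintro ⟨t, s⟩ ⟨ht, rfl⟩ ⟨t', s'⟩ ⟨ht', rfl⟩ h
    simp only at ht ht' h
    rw [hVc t ht, hVc t' ht'] at h
    rw [hinj ht ht' h]
  -- A continuous map that is injective on a compact set and locally injective at its points is
  -- injective on a neighbourhood of it.
  obtain ⟨T, hTo, hKT, hTinj⟩ := hinjK.exists_isOpen_superset (isCompact_Icc.prod isCompact_singleton)
    (by
      rintro ⟨t, s⟩ ⟨ht, rfl⟩
      exact (hlocal t ht).contMDiffAt.continuousAt)
    (by
      rintro ⟨t, s⟩ ⟨ht, rfl⟩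
      obtain ⟨Φ, hΦ, heq⟩ := hlocal t ht
      exact ⟨Φ.source, Φ.open_source.mem_nhds hΦ, Φ.injOn.congr heq.symm⟩)
  -- Three open conditions define the neighbourhood: injectivity, being a local diffeomorphism, and
  -- lying in the domain of the flow.
  obtain ⟨a', b', ε, ha', hb', hε, hbox⟩ := exists_box_subset
    ((hTo.inter (isOpen_setOf_isLocalDiffeomorphAt (n := n) fun q => (Ψ q).1)).inter hΩ) hab.le (by
      rintro ⟨t, s⟩ ⟨ht, hs⟩
      obtain rfl : s = 0 := hs
      exact ⟨⟨hKT ⟨ht, rfl⟩, hlocal t ht⟩, hIcc t ht, h0D⟩)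
  refine ⟨a', b', ε, fun q => (Ψ q).1, ha', hb', hε, hVc,
    isDiffeoOntoRange_of_injOn (isOpen_box a' b' ε) (hTinj.mono fun z hz => (hbox hz).1.1)
      fun z hz => (hbox hz).1.2, fun s hs => ?_⟩
  have hsub : ∀ t ∈ Ioo a' b', (t, s) ∈ Ioo α β ×ˢ D := fun t ht =>
    (hbox (show (t, s) ∈ box n a' b' ε from ⟨ht, fun i _ => hs i⟩)).2
  refine isGeodesicOnOpen_proj hS (σ := fun t => Ψ (t, s)) isOpen_Ioo
    (fun t ht => hΨ.mem s (hsub t ht).2 t (hsub t ht).1) ?_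
    (fun t ht => hΨ.hasMFDerivAt s (hsub t ht).2 t (hsub t ht).1)
  exact hΨ.contMDiffOn.comp (contMDiff_iff_contDiff.2
    (contDiff_id.prodMk contDiff_const)).contMDiffOn hsub
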